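/- A finite mixed graph $G$ has a finite vertex set and edges of two kinds, undirected edges $xy$ and directed edges $\overrightarrow{xy}$; its underlying graph is simple (no loops, and at most one edge, of either kind and direction, between two vertices). An orientable path from $x$ to $y$ is a sequence of distinct vertices from $x$ to $y$ in which each vertex $v$ is joined to its successor $w$ by an undirected edge $vw$ or a directed edge $\overrightarrow{vw}$. $G$ is connected if for all vertices $x,y$ there are orientable paths from $x$ to $y$ and from $y$ to $x$. A bridge is an undirected edge whose deletion disconnects the underlying undirected graph, and $G$ is bridgeless if it is connected and has no bridge. The distance from $x$ to $y$ is the least number of edges of an orientable path from $x$ to $y$, and the diameter is the largest distance. A strong orientation of $G$ is obtained by giving each undirected edge one of its two directions so that the resulting directed graph is strongly connected; the oriented diameter $\overrightarrow{\mathrm{diam}}(G)$ is the minimum diameter of a strong orientation of $G$. For a vertex $u$, let $d^*(u)$, $d^+(u)$, $d^-(u)$ be the numbers of vertices joined to $u$ by an undirected edge, by a directed edge leaving $u$, and by a directed edge entering $u$, respectively, and let $d(u)=d^*(u)+d^+(u)+d^-(u)$. **Theorem.** Let $G$ be a finite bridgeless mixed graph that is bipartite with partite sets $A$ and $B$ (every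 edge, directed or not, joins a vertex of $A$ and a vertex of $B$), and let $u\in B$. Then $G$ has a strong orientation, and $$ \overrightarrow{\mathrm{diam}}(G)\le \begin{cases} 2(|A|-d(u))+7, & \text{if $G$ is undirected (has no directed edges)};\\ 2(|A|-d^*(u))+8, & \text{if } d^+(u)+d^-(u)\ge 2;\\ 2(|A|-d^*(u))+10, & \text{otherwise}. \end{cases} $$ -/

import Mathlib

/-- A mixed graph on the vertex set `V` whose underlying graph is simple: its undirected edges form
a simple graph, its directed edges form a loopless asymmetric relation (`arc x y` is the directed
edge from `x` to `y`), and no pair of vertices carries both kinds of edges. -/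
structure MixedGraph (V : Type*) where
  /-- The undirected edges. -/
  edges : SimpleGraph V
  /-- The directed edges. -/
  arc : V → V → Prop
  arc_irrefl : ∀ x, ¬ arc x x
  arc_asymm : ∀ x y, arc x y → ¬ arc y x
  edges_disjoint_arc : ∀ x y, edges.Adj x y → ¬ arc x y

namespace MixedGraph

variable {V : Type*}

/-- `G.Step x y`: an orientable path may go from `x` to `y` along one edge of `G`. -/
def Step (G : MixedGraph V) (x y : V) : Prop := G.edges.Adj x y ∨ G.arc x y

/-- `p` is the vertex sequence of an orientable path from `x` to `y`: the vertices are distinct,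
and each vertex is joined to the next one by an undirected edge or by a directed edge pointing to
the next one. -/
def IsOrientablePath (G : MixedGraph V) (p : List V) (x y : V) : Prop :=
  p.head? = some x ∧ p.getLast? = some y ∧ p.Nodup ∧ p.IsChain G.Step

/-- Any two vertices are joined by orientable paths in both directions. -/
def IsConnected (G : MixedGraph V) : Prop :=
  ∀ x y, (∃ p, G.IsOrientablePath p x y) ∧ (∃ p, G.IsOrientablePath p y x)

/-- The underlying undirected simple graph: directions are forgotten. -/
def underlying (G : MixedGraph V) : SimpleGraph V where
  Adj x y := G.edges.Adj x y ∨ G.arc x y ∨ G.arc y x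
  symm := ⟨by
    rintro x y (h | h | h)
    · exact Or.inl h.symm
    · exact Or.inr (Or.inr h)
    · exact Or.inr (Or.inl h)⟩
  loopless := ⟨by
    rintro x (h | h | h)
    · exact G.edges.loopless.irrefl x h
    · exact G.arc_irrefl x h
    · exact G.arc_irrefl x h⟩

/-- The mixed graph `G - e` obtained by deleting the undirected edge `e`. -/
def deleteEdge (G : MixedGraph V) (e : Sym2 V) : MixedGraph V where
  edges := G.edges.deleteEdges {e}
  arc := G.arc
  arc_irrefl := G.arc_irrefl
  arc_asymm := G.arc_asymm
  edges_disjoint_arc x y h := G.edges_disjoint_arc x y (G.edges.deleteEdges_le {e} h)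

/-- A bridge is an undirected edge `e` such that `G - e` falls apart, that is, such that the
underlying undirected graph of `G - e` is not connected. (If `G - e` is connected as a mixed
graph, then its underlying graph is connected, so `e` is not a bridge.) -/
def IsBridge (G : MixedGraph V) (e : Sym2 V) : Prop :=
  e ∈ G.edges.edgeSet ∧ ¬ (G.deleteEdge e).underlying.Connected

/-- A mixed graph is bridgeless if it is connected and has no bridge. -/
def IsBridgeless (G : MixedGraph V) : Prop :=
  G.IsConnected ∧ ∀ e, ¬ G.IsBridge e

/-- The distance from `x` to `y`: the least number of edges of an orientable path from `x` to `y`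
(`⊤` if there is none). -/
noncomputable def dist (G : MixedGraph V) (x y : V) : ℕ∞ :=
  ⨅ p ∈ {p : List V | G.IsOrientablePath p x y}, ((p.length - 1 : ℕ) : ℕ∞)

/-- The diameter: the largest distance between two vertices. -/
noncomputable def diam (G : MixedGraph V) : ℕ∞ := ⨆ (x : V) (y : V), G.dist x y

/-- `N⁺(x)`. -/
def outNeighbors (G : MixedGraph V) (x : V) : Set V := {y | G.arc x y}

/-- `N⁻(x)`. -/
def inNeighbors (G : MixedGraph V) (x : V) : Set V := {y | G.arc y x}

/-- `N*(x)`. -/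
def undirNeighbors (G : MixedGraph V) (x : V) : Set V := {y | G.edges.Adj x y}

/-- `N(x)`. -/
def neighbors (G : MixedGraph V) (x : V) : Set V :=
  G.outNeighbors x ∪ G.inNeighbors x ∪ G.undirNeighbors x

/-- `d⁺(x)`. -/
noncomputable def outDegree (G : MixedGraph V) (x : V) : ℕ := (G.outNeighbors x).ncard

/-- `d⁻(x)`. -/
noncomputable def inDegree (G : MixedGraph V) (x : V) : ℕ := (G.inNeighbors x).ncard

/-- `d*(x)`. -/
noncomputable def undirDegree (G : MixedGraph V) (x : V) : ℕ := (G.undirNeighbors x).ncard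

/-- `d(x)`. -/
noncomputable def degree (G : MixedGraph V) (x : V) : ℕ := (G.neighbors x).ncard

/-- All edges are undirected. -/
def IsUndirected (G : MixedGraph V) : Prop := ∀ x y, ¬ G.arc x y

/-- All edges are directed. -/
def IsDirected (G : MixedGraph V) : Prop := ∀ x y, ¬ G.edges.Adj x y

/-- `D` is an orientation of `G`: all its edges are directed, it keeps the directed edges of `G`,
it contains every undirected edge of `G` in one of its two directions (and only in one, since `D`
is a mixed graph), and it has no further edges. -/
def IsOrientation (D G : MixedGraph V) : Prop :=
  D.IsDirected ∧
  (∀ x y, G.arc x y → D.arc x y) ∧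
  (∀ x y, G.edges.Adj x y → D.arc x y ∨ D.arc y x) ∧
  (∀ x y, D.arc x y → G.edges.Adj x y ∨ G.arc x y)

/-- A strong orientation of `G` is an orientation of `G` that is (strongly) connected. -/
def IsStrongOrientation (D G : MixedGraph V) : Prop := IsOrientation D G ∧ D.IsConnected

/-- The oriented diameter: the least diameter of a strong orientation of `G` (`⊤` if `G` has no
strong orientation, so that a finite upper bound includes the existence of one). -/
noncomputable def orientedDiam (G : MixedGraph V) : ℕ∞ :=
  ⨅ D ∈ {D : MixedGraph V | IsStrongOrientation D G}, D.diam

/-- `G` is bipartite with partite sets `A` and `B`: they partition the vertex set, and every edge,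
undirected or directed, joins a vertex of `A` and a vertex of `B`. -/
def IsBipartiteWith (G : MixedGraph V) (A B : Set V) : Prop :=
  A ∪ B = Set.univ ∧ Disjoint A B ∧
  ∀ x y, G.edges.Adj x y ∨ G.arc x y → (x ∈ A ∧ y ∈ B) ∨ (x ∈ B ∧ y ∈ A)

end MixedGraph

/-! Edges alternate between `A` and `B`, so the length of a path is twice its number of vertices in
`A`, corrected at the ends (`IsBipartiteWith.length_path`). Hence it suffices to find an orientation
in which any `x` reaches any `y` inside a set `S` containing few neighbors of `u`: the rest of `A`
contributes at most `|A|` minus the number of neighbors, and each neighbor in `S` costs 2. All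
routes go from `x` to `u` and then to `y`.

A strong orientation exists by Boesch and Tindell (`exists_isStrongOrientation`). In the mixed case
keep it except at the undirected edges between `u` and `N = N*(u)`, which are redirected according
to a set `J`: vertices of `J` point to `u`, the others are pointed to. Paths outside `u` and `N`
define a digraph of links on `N`. A minimal admissible `J` (`exists_absorbing`) gives routes to `u`
meeting `N` at most twice and routes from `u` meeting it at most three times. So at most 5 vertices
of `N` are used, whence the constant 10.

If at least two directed edges meet `u`, their ends are counted along with `N`. Under `InSpread`, or
its mirror image, a route using 5 vertices of `N` misses one such end, which saves 2. Otherwise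
there is exactly one out-neighbor `p` and one in-neighbor `q`, and `p` reaches `q` off `N`; then `p`
and `q` join `N` with their labels fixed, and a two-step labelling (`exists_two_step_absorbing`)
uses 3 + 3 = 6 = 2 + 4 vertices.

In the undirected case more edges are fixed beforehand: from `u` to the neighbors outside `I`,
through every component of the rest that touches both labels, into `I`, and back to `u`. The result
is still connected, so Boesch and Tindell orient what remains (`exists_isSplit`). Routes to and from
`u` use two neighbors each, which gives 8; an end in `A` saves 1. If both ends lie in `B`, a careful
choice of `I` (`exists_isEconomical`) saves a vertex of `A`; the choice depends on the components
attached to a single neighbor of `u`. -/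

open Relation

namespace MixedGraph

variable {V : Type*}

/-! ### Reachability inside a set, and lengths of paths in bipartite graphs. -/

theorem reflTransGen_of_imp {r r' : V → V → Prop} (h : ∀ a b, r a b → r' a b) {x y : V}
    (hxy : ReflTransGen r x y) : ReflTransGen r' x y := by
  induction hxy with
  | refl => exact ReflTransGen.refl
  | tail _ h' ih => exact ih.tail (h _ _ h')

theorem reflTransGen_flip {r : V → V → Prop} {x y : V} (h : ReflTransGen r x y) :
    ReflTransGen (fun a b => r b a) y x :=
  reflTransGen_swap.1 h

/-- `y` can be reached from `x` by steps of `r` that stay inside `S`. -/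
def ReachIn (r : V → V → Prop) (S : Set V) : V → V → Prop :=
  ReflTransGen (fun a b => r a b ∧ a ∈ S ∧ b ∈ S)

theorem ReachIn.mono {r r' : V → V → Prop} {S S' : Set V} {x y : V} (h : ReachIn r S x y)
    (hr : ∀ a b, a ∈ S → b ∈ S → r a b → r' a b) (hS : S ⊆ S') : ReachIn r' S' x y :=
  reflTransGen_of_imp (fun a b h => ⟨hr a b h.2.1 h.2.2 h.1, hS h.2.1, hS h.2.2⟩) h

theorem ReachIn.mono_set {r : V → V → Prop} {S S' : Set V} {x y : V} (h : ReachIn r S x y)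
    (hS : S ⊆ S') : ReachIn r S' x y :=
  h.mono (fun _ _ _ _ h => h) hS

theorem ReachIn.trans {r : V → V → Prop} {S : Set V} {x y z : V} (h : ReachIn r S x y)
    (h' : ReachIn r S y z) : ReachIn r S x z :=
  ReflTransGen.trans h h'

theorem ReachIn.single {r : V → V → Prop} {S : Set V} {x y : V} (h : r x y) (hx : x ∈ S)
    (hy : y ∈ S) : ReachIn r S x y :=
  ReflTransGen.single ⟨h, hx, hy⟩

theorem ReachIn.reflTransGen {r : V → V → Prop} {S : Set V} {x y : V} (h : ReachIn r S x y) :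
    ReflTransGen r x y :=
  reflTransGen_of_imp (fun _ _ h => h.1) h

theorem ReachIn.swap {r : V → V → Prop} {S : Set V} {x y : V} (h : ReachIn r S x y) :
    ReachIn (fun a b => r b a) S y x :=
  reflTransGen_of_imp (fun _ _ h => ⟨h.1, h.2.2, h.2.1⟩) (reflTransGen_flip h)

/-- A path is confined to the vertices lying between its ends. -/
theorem reachIn_between {r : V → V → Prop} {x y : V} (h : ReflTransGen r x y) :
    ReachIn r {a | ReflTransGen r x a ∧ ReflTransGen r a y} x y := by
  induction h using ReflTransGen.head_induction_on with
  | refl => exact ReflTransGen.refl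
  | head h1 h2 ih =>
    exact ReflTransGen.head ⟨h1, ⟨ReflTransGen.refl, h2.head h1⟩, ⟨ReflTransGen.single h1, h2⟩⟩
      (ih.mono_set fun a ha => ⟨ha.1.head h1, ha.2⟩)

theorem ReachIn.exists_path {r : V → V → Prop} {S : Set V} {x y : V} (h : ReachIn r S x y)
    (hx : x ∈ S) : ∃ p : List V, p.head? = some x ∧ p.getLast? = some y ∧ p.Nodup ∧
      p.IsChain r ∧ ∀ a ∈ p, a ∈ S := by
  induction h using ReflTransGen.head_induction_on with
  | refl => exact ⟨[y], by simpa using hx⟩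
  | @head a c h1 h2 ih =>
    obtain ⟨p, hp1, hp2, hp3, hp4, hp5⟩ := ih h1.2.2
    by_cases ha : a ∈ p
    · obtain ⟨s, t, rfl⟩ := List.append_of_mem ha
      refine ⟨a :: t, rfl, ?_, (List.nodup_append.1 hp3).2.1, hp4.right_of_append, ?_⟩
      · simpa using hp2
      · exact fun b hb => hp5 b (List.mem_append_right _ hb)
    · obtain ⟨q, rfl⟩ : ∃ q, p = c :: q := by
        cases p with
        | nil => simp at hp1
        | cons d q => simp at hp1; exact ⟨q, by rw [hp1]⟩
      refine ⟨a :: c :: q, rfl, by simpa using hp2, List.nodup_cons.2 ⟨ha, hp3⟩,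
        List.IsChain.cons_cons h1.1 hp4, ?_⟩
      intro b hb
      rcases List.mem_cons.1 hb with rfl | hb
      · exact h1.2.1
      · exact hp5 b hb

theorem isConnected_iff {G : MixedGraph V} :
    G.IsConnected ↔ ∀ x y, ReflTransGen G.Step x y := by
  constructor
  · intro h x y
    obtain ⟨p, h1, h2, -, h4⟩ := (h x y).1
    cases p with
    | nil => simp at h1
    | cons a q =>
      simp only [List.head?_cons, Option.some.injEq] at h1
      subst h1
      have := List.relationReflTransGen_of_exists_isChain_cons q h4
        (b := y) (by rw [List.getLast?_eq_some_getLast (by simp)] at h2; simpa using h2)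
      exact this
  · intro h
    have key : ∀ x y, ∃ p, G.IsOrientablePath p x y := by
      intro x y
      have h' : ReachIn G.Step Set.univ x y :=
        reflTransGen_of_imp (fun a b hab => ⟨hab, trivial, trivial⟩) (h x y)
      obtain ⟨p, h1, h2, h3, h4, -⟩ := h'.exists_path trivial
      exact ⟨p, h1, h2, h3, h4⟩
    exact fun x y => ⟨key x y, key y x⟩

open Classical in
theorem IsBipartiteWith.length_path {G : MixedGraph V} {A B : Set V}
    (hAB : G.IsBipartiteWith A B) {p : List V} {x y : V} (h1 : p.head? = some x)
    (h2 : p.getLast? = some y) (h : p.IsChain G.Step) :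
    p.length + (if x ∈ A then 1 else 0) + (if y ∈ A then 1 else 0) =
      2 * (p.filter (· ∈ A)).length + 1 := by
  induction p generalizing x with
  | nil => simp at h1
  | cons a q ih =>
    simp only [List.head?_cons, Option.some.injEq] at h1
    subst h1
    cases q with
    | nil =>
      simp only [List.getLast?_singleton, Option.some.injEq] at h2
      subst h2
      by_cases ha : a ∈ A <;> simp [ha]
    | cons c t =>
      rw [List.isChain_cons_cons] at h
      have := ih (x := c) rfl (by simpa using h2) h.2
      have hd : ∀ v, v ∈ A → v ∉ B := fun v hv hv' => Set.disjoint_left.1 hAB.2.1 hv hv'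
      rcases hAB.2.2 a c h.1 with ⟨ha, hc⟩ | ⟨ha, hc⟩
      · have hc' : c ∉ A := fun h => hd _ h hc
        rw [List.filter_cons_of_pos (by simpa using ha)]
        simp only [List.length_cons, ha, hc', if_true, if_false] at this ⊢
        omega
      · have ha' : a ∉ A := fun h => hd _ h ha
        rw [List.filter_cons_of_neg (by simpa using ha')]
        simp only [List.length_cons, ha', hc, if_true, if_false] at this ⊢
        omega

open Classical in
-- A path inside `S` visits each vertex of `A ∩ S` at most once. Every distance bound below is thus
-- reduced to a bound on `(A ∩ S).ncard`.
theorem IsBipartiteWith.dist_le [Finite V] {G : MixedGraph V} {A B S : Set V}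
    (hAB : G.IsBipartiteWith A B) {x y : V} (hS : ReachIn G.Step S x y) (hx : x ∈ S) {n : ℕ}
    (hn : 2 * (A ∩ S).ncard ≤ n + (if x ∈ A then 1 else 0) + (if y ∈ A then 1 else 0)) :
    G.dist x y ≤ n := by
  obtain ⟨p, h1, h2, h3, h4, h5⟩ := hS.exists_path hx
  refine (iInf₂_le p (show p ∈ {p | G.IsOrientablePath p x y} from ⟨h1, h2, h3, h4⟩)).trans ?_
  have hl := hAB.length_path h1 h2 h4
  have hc : (p.filter (· ∈ A)).length ≤ (A ∩ S).ncard := by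
    rw [← List.toFinset_card_of_nodup (h3.filter _), ← Set.ncard_coe_finset]
    refine Set.ncard_le_ncard ?_ (Set.toFinite _)
    intro a ha
    simp only [List.coe_toFinset, List.mem_filter, decide_eq_true_eq, Set.mem_ofPred_eq] at ha
    exact ⟨ha.2, h5 a ha.1⟩
  have : p.length - 1 ≤ n := by omega
  exact_mod_cast this

theorem orientedDiam_le {G D : MixedGraph V} (hD : D.IsStrongOrientation G) {n : ℕ∞}
    (h : ∀ x y, D.dist x y ≤ n) : G.orientedDiam ≤ n :=
  (iInf₂_le D hD).trans (iSup₂_le h)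

/-! ### Partial orientations and the theorem of Boesch and Tindell. -/

/-- The undirected edges chosen by `F` become directed, along `F`. -/
def orientBy (G : MixedGraph V) (F : V → V → Prop) (hF : ∀ a b, F a b → ¬ F b a) :
    MixedGraph V where
  edges :=
    { Adj := fun a b => G.edges.Adj a b ∧ ¬ F a b ∧ ¬ F b a
      symm := ⟨fun _ _ h => ⟨h.1.symm, h.2.2, h.2.1⟩⟩
      loopless := ⟨fun a h => G.edges.loopless.irrefl a h.1⟩ }
  arc a b := G.arc a b ∨ (G.edges.Adj a b ∧ F a b)
  arc_irrefl x := by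
    rintro (h | h)
    · exact G.arc_irrefl x h
    · exact G.edges.loopless.irrefl x h.1
  arc_asymm x y := by
    rintro (h | h) (h' | h')
    · exact G.arc_asymm x y h h'
    · exact G.edges_disjoint_arc _ _ h'.1.symm h
    · exact G.edges_disjoint_arc _ _ h.1.symm h'
    · exact hF _ _ h.2 h'.2
  edges_disjoint_arc x y h := by
    rintro (h' | h')
    · exact G.edges_disjoint_arc _ _ h.1 h'
    · exact h.2.1 h'.2

theorem orientBy_step {G : MixedGraph V} {F : V → V → Prop} {hF : ∀ a b, F a b → ¬ F b a}
    {a b : V} : (G.orientBy F hF).Step a b ↔ G.arc a b ∨ (G.edges.Adj a b ∧ ¬ F b a) := by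
  constructor
  · rintro (h | h | h)
    · exact Or.inr ⟨h.1, h.2.2⟩
    · exact Or.inl h
    · exact Or.inr ⟨h.1, hF _ _ h.2⟩
  · rintro (h | h)
    · exact Or.inr (Or.inl h)
    · by_cases hab : F a b
      · exact Or.inr (Or.inr ⟨h.1, hab⟩)
      · exact Or.inl ⟨h.1, hab, h.2⟩

theorem orientBy_deleteEdge_underlying (G : MixedGraph V) (F : V → V → Prop)
    (hF : ∀ a b, F a b → ¬ F b a) (e : Sym2 V) (he : e ∈ (G.orientBy F hF).edges.edgeSet) :
    ((G.orientBy F hF).deleteEdge e).underlying = (G.deleteEdge e).underlying := by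
  induction e using Sym2.ind with | _ p q =>
  have he' : G.edges.Adj p q ∧ ¬ F p q ∧ ¬ F q p := he
  ext a b
  simp only [underlying, deleteEdge, orientBy, SimpleGraph.deleteEdges_adj,
    Set.mem_singleton_iff]
  have h1 : F a b → s(a, b) ≠ s(p, q) := by
    intro h h'
    rcases Sym2.eq_iff.1 h' with ⟨rfl, rfl⟩ | ⟨rfl, rfl⟩
    · exact he'.2.1 h
    · exact he'.2.2 h
  have h2 : F b a → s(a, b) ≠ s(p, q) := by
    intro h h'
    rcases Sym2.eq_iff.1 h' with ⟨rfl, rfl⟩ | ⟨rfl, rfl⟩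
    · exact he'.2.2 h
    · exact he'.2.1 h
  have h3 := G.edges.adj_comm a b
  tauto

/-- Orienting edges does not change the underlying graph, so no bridge can appear; only
connectedness has to be checked. -/
theorem orientBy_bridgeless {G : MixedGraph V} (hG : G.IsBridgeless) {F : V → V → Prop}
    {hF : ∀ a b, F a b → ¬ F b a} (hc : (G.orientBy F hF).IsConnected) :
    (G.orientBy F hF).IsBridgeless := by
  refine ⟨hc, fun e he => hG.2 e ⟨?_, ?_⟩⟩
  · revert he
    induction e using Sym2.ind with | _ p q =>
    intro he
    have he' : G.edges.Adj p q ∧ ¬ F p q ∧ ¬ F q p := he.1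
    exact he'.1
  · rw [← G.orientBy_deleteEdge_underlying F hF e he.1]
    exact he.2

theorem IsStrongOrientation.of_orientBy {G D : MixedGraph V} {F : V → V → Prop}
    {hF : ∀ a b, F a b → ¬ F b a} (h : D.IsStrongOrientation (G.orientBy F hF)) :
    D.IsStrongOrientation G := by
  obtain ⟨⟨h1, h2, h3, h4⟩, h5⟩ := h
  refine ⟨⟨h1, fun x y h => h2 x y (Or.inl h), ?_, ?_⟩, h5⟩
  · intro x y h
    by_cases hxy : F x y
    · exact Or.inl (h2 _ _ (Or.inr ⟨h, hxy⟩))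
    by_cases hyx : F y x
    · exact Or.inr (h2 _ _ (Or.inr ⟨h.symm, hyx⟩))
    · exact h3 x y ⟨h, hxy, hyx⟩
  · intro x y h
    rcases h4 x y h with h | h | h
    · exact Or.inl h.1
    · exact Or.inr h
    · exact Or.inl h.1

/-- A non-bridge of a connected mixed graph can be oriented so that the graph stays connected. -/
theorem exists_orient_edge {G : MixedGraph V} (hG : G.IsConnected) {x y : V}
    (hb : (G.deleteEdge s(x, y)).underlying.Connected) :
    (∀ a b, ReflTransGen (fun a b => G.arc a b ∨ (G.edges.Adj a b ∧ ¬ (b = x ∧ a = y))) a b) ∨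
    (∀ a b, ReflTransGen (fun a b => G.arc a b ∨ (G.edges.Adj a b ∧ ¬ (b = y ∧ a = x))) a b) := by
  rw [isConnected_iff] at hG
  set r : V → V → Prop := (G.deleteEdge s(x, y)).Step with hr
  have hr_iff : ∀ a b, r a b ↔ G.arc a b ∨ (G.edges.Adj a b ∧ s(a, b) ≠ s(x, y)) := by
    intro a b
    simp only [hr, Step, deleteEdge, SimpleGraph.deleteEdges_adj, Set.mem_singleton_iff]
    tauto
  have hstep : ∀ a b, G.Step a b → r a b ∨ (a = x ∧ b = y) ∨ (a = y ∧ b = x) := by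
    intro a b h
    rw [hr_iff]
    have : s(a, b) = s(x, y) ↔ _ := Sym2.eq_iff
    unfold Step at h
    tauto
  -- If `y` reaches `x` without the edge, that detour replaces the step from `y` to `x`, and the
  -- edge can be directed from `x` to `y`.
  by_cases h1 : ReflTransGen r y x
  · left
    intro a b
    have hle : ∀ a b, ReflTransGen r a b → ReflTransGen
        (fun a b => G.arc a b ∨ (G.edges.Adj a b ∧ ¬ (b = x ∧ a = y))) a b := by
      intro a b h
      refine reflTransGen_of_imp ?_ h
      intro a b h
      rcases (hr_iff a b).1 h with h | h
      · exact Or.inl h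
      · exact Or.inr ⟨h.1, by rintro ⟨rfl, rfl⟩; exact h.2 Sym2.eq_swap⟩
    induction hG a b with
    | refl => exact ReflTransGen.refl
    | @tail c d _ h2 ih =>
      refine ih.trans ?_
      by_cases hcd : d = x ∧ c = y
      · rw [hcd.1, hcd.2]; exact hle _ _ h1
      · refine ReflTransGen.single ?_
        unfold Step at h2
        tauto
  by_cases h2 : ReflTransGen r x y
  · right
    intro a b
    have hle : ∀ a b, ReflTransGen r a b → ReflTransGen
        (fun a b => G.arc a b ∨ (G.edges.Adj a b ∧ ¬ (b = y ∧ a = x))) a b := by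
      intro a b h
      refine reflTransGen_of_imp ?_ h
      intro a b h
      rcases (hr_iff a b).1 h with h | h
      · exact Or.inl h
      · exact Or.inr ⟨h.1, by rintro ⟨rfl, rfl⟩; exact h.2 rfl⟩
    induction hG a b with
    | refl => exact ReflTransGen.refl
    | @tail c d _ h2' ih =>
      refine ih.trans ?_
      by_cases hcd : d = y ∧ c = x
      · rw [hcd.1, hcd.2]; exact hle _ _ h2
      · refine ReflTransGen.single ?_
        unfold Step at h2'
        tauto
  -- Now neither end reaches the other without the edge. As the edge is no bridge, some other edge
  -- joins the set reached from `y` to its complement, and it must be an arc from `b` outside to `a`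
  -- inside. Then `x` reaches `b`, and `a` reaches `x` or `y`, so one end reaches the other after
  -- all.
  exfalso
  obtain ⟨a, b, ha, hb', hab⟩ : ∃ a b, ReflTransGen r y a ∧ ¬ ReflTransGen r y b ∧
      (G.deleteEdge s(x, y)).underlying.Adj a b := by
    by_contra! hcon
    have : ∀ c, (G.deleteEdge s(x, y)).underlying.Reachable y c → ReflTransGen r y c := by
      intro c hc
      rw [SimpleGraph.reachable_iff_reflTransGen] at hc
      induction hc with
      | refl => exact ReflTransGen.refl
      | tail _ h ih =>
        by_contra hn
        exact hcon _ _ ih hn h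
    exact h1 (this x (hb.preconnected y x))
  have hba : r b a := by
    rcases hab with h | h | h
    · exact Or.inl h.symm
    · exact absurd (ha.tail (show r a b from Or.inr h)) hb'
    · exact Or.inr h
  have hxb : ReflTransGen r x b := by
    have : ∀ c, ReflTransGen G.Step a c → ReflTransGen r y c ∨ ReflTransGen r x c := by
      intro c hc
      induction hc with
      | refl => exact Or.inl ha
      | tail _ h ih =>
        rcases hstep _ _ h with h | ⟨-, rfl⟩ | ⟨-, rfl⟩
        · exact ih.imp (·.tail h) (·.tail h)
        · exact Or.inl ReflTransGen.refl
        · exact Or.inr ReflTransGen.refl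
    exact (this b (hG a b)).resolve_left hb'
  have hay : ReflTransGen r a y ∨ ReflTransGen r a x := by
    clear ha hab hba
    induction hG a y using ReflTransGen.head_induction_on with
    | refl => exact Or.inl ReflTransGen.refl
    | head h _ ih =>
      rcases hstep _ _ h with h | ⟨rfl, -⟩ | ⟨rfl, -⟩
      · exact ih.imp (·.head h) (·.head h)
      · exact Or.inr ReflTransGen.refl
      · exact Or.inl ReflTransGen.refl
  rcases hay with h | h
  · exact h2 ((hxb.tail hba).trans h)
  · exact h1 (ha.trans h)

/-- Boesch and Tindell: a bridgeless mixed graph has a strong orientation. -/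
theorem exists_isStrongOrientation [Finite V] {G : MixedGraph V} (hG : G.IsBridgeless) :
    ∃ D : MixedGraph V, D.IsStrongOrientation G := by
  obtain ⟨n, hn⟩ : ∃ n, G.edges.edgeSet.ncard = n := ⟨_, rfl⟩
  induction n using Nat.strong_induction_on generalizing G with
  | _ n ih =>
    by_cases he : ∃ x y, G.edges.Adj x y
    · obtain ⟨x, y, hxy⟩ := he
      have step : ∀ x y, G.edges.Adj x y → (∀ a b, ReflTransGen
          (fun a b => G.arc a b ∨ (G.edges.Adj a b ∧ ¬ (b = x ∧ a = y))) a b) →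
          ∃ D : MixedGraph V, D.IsStrongOrientation G := by
        intro x y hxy hc
        have hF : ∀ a b, (a = x ∧ b = y) → ¬ (b = x ∧ a = y) := by
          rintro a b ⟨rfl, rfl⟩ ⟨h, -⟩
          exact G.edges.ne_of_adj hxy h.symm
        have hb : (G.orientBy (fun a b => a = x ∧ b = y) hF).IsBridgeless := by
          refine orientBy_bridgeless hG (isConnected_iff.2 fun a b => ?_)
          exact reflTransGen_of_imp (fun c d h => orientBy_step.2 h) (hc a b)
        have hlt : (G.orientBy (fun a b => a = x ∧ b = y) hF).edges.edgeSet.ncard < n := by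
          rw [← hn]
          refine Set.ncard_lt_ncard ⟨?_, ?_⟩ (Set.toFinite _)
          · exact SimpleGraph.edgeSet_mono fun a b h => h.1
          · intro hsub
            have h : s(x, y) ∈ (G.orientBy (fun a b => a = x ∧ b = y) hF).edges.edgeSet :=
              hsub hxy
            exact h.2.1 ⟨rfl, rfl⟩
        obtain ⟨D, hD⟩ := ih _ hlt hb rfl
        exact ⟨D, hD.of_orientBy⟩
      have hb : (G.deleteEdge s(x, y)).underlying.Connected := by
        by_contra h
        exact hG.2 _ ⟨hxy, h⟩
      rcases exists_orient_edge hG.1 hb with h | h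
      · exact step x y hxy h
      · exact step y x hxy.symm h
    · push Not at he
      exact ⟨G, ⟨he, fun _ _ h => h, fun x y h => absurd h (he x y), fun _ _ h => Or.inr h⟩,
        hG.1⟩

/-! ### Labellings of a digraph by minimality. -/

theorem exists_minimal_set [Finite V] {P : Set V → Prop} {J₀ : Set V} (h : P J₀) :
    ∃ J, P J ∧ ∀ w ∈ J, ¬ P (J \ {w}) := by
  obtain ⟨J, hJ⟩ := exists_minimal_of_wellFoundedLT P ⟨J₀, h⟩
  refine ⟨J, hJ.1, fun w hw hP => ?_⟩
  exact (hJ.2 hP Set.sdiff_subset hw).2 rfl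

/-- A labelling of the vertices of a digraph: outside `J ∪ Xm`, every vertex has an out-neighbor
in `J ∪ Xm`, and every vertex of `J` is near to the complement of `J` or to `Xp`. -/
theorem exists_absorbing [Finite V] {L : V → V → Prop} (hL : ∀ v, ¬ L v v) {N Xp Xm : Set V}
    (hN : ∀ v t, L v t → v ∈ N ∧ t ∈ N) (hXp : Xp ⊆ N)
    (hiso : ∀ v ∈ N, v ∈ Xp ∨ v ∈ Xm ∨ (∃ t, L t v) ∨ (∃ t, L v t)) :
    ∃ J ⊆ N, Xp ⊆ J ∧ (∀ v ∈ J, v ∈ Xm → v ∈ Xp) ∧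
      (∀ v ∈ N, v ∉ J → v ∈ Xm ∨ ∃ t, L v t ∧ (t ∈ J ∨ t ∈ Xm)) ∧
      (∀ w ∈ J, w ∈ Xp ∨ (∃ v, v ∉ J ∧ L v w) ∨ (∃ t ∈ Xp, L t w) ∨
        ∃ t ∈ J, t ∉ Xp ∧ L t w ∧ ∃ v, v ∉ J ∧ v ∉ Xm ∧ L v t) := by
  obtain ⟨J, ⟨c1, c2, c3, c4, c5⟩, hmin⟩ := exists_minimal_set (P := fun J : Set V =>
    Xp ⊆ J ∧ J ⊆ N ∧ (∀ v ∈ J, v ∈ Xm → v ∈ Xp) ∧ (∀ v ∈ J, v ∈ Xp ∨ ∃ t, L t v) ∧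
      (∀ v ∈ N, v ∉ J → v ∈ Xm ∨ ∃ t, L v t ∧ (t ∈ J ∨ t ∈ Xm)))
    (J₀ := {v | v ∈ N ∧ (v ∈ Xm → v ∈ Xp) ∧ (v ∈ Xp ∨ ∃ t, L t v)}) (by
      refine ⟨fun v hv => ⟨hXp hv, fun _ => hv, Or.inl hv⟩, fun v hv => hv.1,
        fun v hv => hv.2.1, fun v hv => hv.2.2, fun v hv hvJ => ?_⟩
      by_cases hm : v ∈ Xm
      · exact Or.inl hm
      right
      have h1 : v ∉ Xp := fun h => hvJ ⟨hv, fun _ => h, Or.inl h⟩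
      have h2 : ¬ ∃ t, L t v := fun h => hvJ ⟨hv, fun h => absurd h hm, Or.inr h⟩
      rcases hiso v hv with h | h | h | ⟨t, h⟩
      · exact absurd h h1
      · exact absurd h hm
      · exact absurd h h2
      refine ⟨t, h, ?_⟩
      by_cases ht : t ∈ Xm
      · exact Or.inr ht
      · exact Or.inl ⟨(hN _ _ h).2, fun h => absurd h ht, Or.inr ⟨v, h⟩⟩)
  refine ⟨J, c2, c1, c3, c5, ?_⟩
  -- Removing `w` can only violate the last condition: either some vertex outside `J` depends on
  -- `w`, or `w` itself has no successor in `J`.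
  have key : ∀ w ∈ J, w ∉ Xp → (∃ v, v ∉ J ∧ v ∉ Xm ∧ L v w) ∨ ∀ t, L w t → t ∉ J := by
    intro w hw hwX
    by_contra! hcon
    obtain ⟨hα, t, hwt, htJ⟩ := hcon
    refine hmin w hw ⟨?_, Set.sdiff_subset.trans c2, fun v hv => c3 v hv.1,
      fun v hv => c4 v hv.1, ?_⟩
    · exact fun v hv => ⟨c1 hv, by rintro rfl; exact hwX hv⟩
    intro v hv hvJ
    by_cases hm : v ∈ Xm
    · exact Or.inl hm
    right
    by_cases hvw : v = w
    · subst hvw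
      exact ⟨t, hwt, Or.inl ⟨htJ, by rintro rfl; exact hL _ hwt⟩⟩
    · have hvJ' : v ∉ J := fun h => hvJ ⟨h, hvw⟩
      obtain ⟨s, hs, h⟩ := (c5 v hv hvJ').resolve_left hm
      have hsw : s ≠ w := by rintro rfl; exact hα v hvJ' hm hs
      exact ⟨s, hs, h.imp_left fun h => ⟨h, hsw⟩⟩
  intro w hw
  by_cases hwX : w ∈ Xp
  · exact Or.inl hwX
  right
  obtain ⟨t, ht⟩ := (c4 w hw).resolve_left hwX
  by_cases htJ : t ∈ J
  · right
    by_cases htX : t ∈ Xp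
    · exact Or.inl ⟨t, htX, ht⟩
    · right
      -- The successor `w` of `t` lies in `J`, so minimality at `t` must come from a vertex outside
      -- `J` that depends on `t`.
      refine ⟨t, htJ, htX, ht, (key t htJ htX).resolve_right fun h => h w ht hw⟩
  · exact Or.inl ⟨t, htJ, ht⟩

/-- A labelling of the vertices of a digraph without isolated vertices: every vertex outside `J`
is at most two steps away from `J`, and conversely. -/
theorem exists_two_step_absorbing [Finite V] {L : V → V → Prop} (hL : ∀ v, ¬ L v v) {N : Set V}
    (hiso : ∀ v ∈ N, (∃ t, L t v) ∨ (∃ t, L v t)) {p q : V} (hpq : L p q) :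
    ∃ J : Set V, p ∉ J ∧ q ∈ J ∧
      (∀ v ∈ N, v ∉ J → ∃ t, L v t ∧ (t ∈ J ∨ ∃ t', L t t' ∧ t' ∈ J)) ∧
      (∀ w ∈ J, ∃ t, L t w ∧ (t ∉ J ∨ ∃ t', L t' t ∧ t' ∉ J)) := by
  have hne : p ≠ q := by rintro rfl; exact hL _ hpq
  obtain ⟨J, ⟨c1, c2, c4, c5⟩, hmin⟩ := exists_minimal_set (P := fun J : Set V =>
    p ∉ J ∧ q ∈ J ∧ (∀ v ∈ J, ∃ t, L t v) ∧
      (∀ v ∈ N, v ∉ J → ∃ t, L v t ∧ (t ∈ J ∨ ∃ t', L t t' ∧ t' ∈ J)))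
    (J₀ := {v | v ≠ p ∧ ∃ t, L t v}) (by
      have hq : q ∈ {v | v ≠ p ∧ ∃ t, L t v} := ⟨hne.symm, p, hpq⟩
      refine ⟨fun h => h.1 rfl, hq, fun v hv => hv.2, fun v hv hvJ => ?_⟩
      by_cases hvp : v = p
      · subst hvp
        exact ⟨q, hpq, Or.inl hq⟩
      · obtain ⟨t, ht⟩ := (hiso v hv).resolve_left fun h => hvJ ⟨hvp, h⟩
        -- Since `p` is kept out of `J`, a vertex whose successor is `p` needs a second step, to
        -- `q`.
        by_cases htp : t = p
        · subst htp
          exact ⟨t, ht, Or.inr ⟨q, hpq, hq⟩⟩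
        · exact ⟨t, ht, Or.inl ⟨htp, v, ht⟩⟩)
  refine ⟨J, c1, c2, c5, ?_⟩
  -- As before, but a vertex may now depend on `w` through an intermediate vertex outside `J`.
  have key : ∀ w ∈ J, w ≠ q →
      (∃ v, v ∉ J ∧ (L v w ∨ ∃ t, t ∉ J ∧ L v t ∧ L t w)) ∨ ∀ t, L w t → t ∉ J := by
    intro w hw hwq
    by_contra! hcon
    obtain ⟨hα, t, hwt, htJ⟩ := hcon
    refine hmin w hw ⟨fun h => c1 h.1, ⟨c2, hwq.symm⟩, fun v hv => c4 v hv.1, ?_⟩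
    intro v hv hvJ
    by_cases hvw : v = w
    · subst hvw
      exact ⟨t, hwt, Or.inl ⟨htJ, by rintro rfl; exact hL _ hwt⟩⟩
    · have hvJ' : v ∉ J := fun h => hvJ ⟨h, hvw⟩
      obtain ⟨s, hs, h⟩ := c5 v hv hvJ'
      have hsw : s ≠ w := by rintro rfl; exact (hα v hvJ').1 hs
      by_cases hsJ : s ∈ J
      · exact ⟨s, hs, Or.inl ⟨hsJ, hsw⟩⟩
      · obtain ⟨r, hr, hrJ⟩ := h.resolve_left hsJ
        exact ⟨s, hs, Or.inr ⟨r, hr, hrJ, by rintro rfl; exact (hα v hvJ').2 s hsJ hs hr⟩⟩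
  intro w hw
  obtain ⟨t, ht⟩ := c4 w hw
  by_cases htJ : t ∈ J
  · by_cases htq : t = q
    · subst htq
      exact ⟨t, ht, Or.inr ⟨p, hpq, c1⟩⟩
    · obtain ⟨v, hvJ, hv | ⟨s, hs, -, hst⟩⟩ := (key t htJ htq).resolve_right fun h => h w ht hw
      · exact ⟨t, ht, Or.inr ⟨v, hv, hvJ⟩⟩
      · exact ⟨t, ht, Or.inr ⟨s, hst, hs⟩⟩
  · exact ⟨t, ht, Or.inl htJ⟩

/-! ### Redirecting the edges at the root, and links between its neighbors. -/

/-- The vertices of `J` get an arc to `u`, the other vertices of `N` an arc from `u`. -/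
def relabel (E : V → V → Prop) (N : Set V) (u : V) (J : Set V) (a b : V) : Prop :=
  E a b ∨ (a ∈ N ∧ a ∈ J ∧ b = u) ∨ (a = u ∧ b ∈ N ∧ b ∉ J)

/-- Reachability by paths on which only the last vertex may belong to `W`. -/
def FreeReach (E : V → V → Prop) (W : Set V) : V → V → Prop :=
  ReflTransGen (fun a b => E a b ∧ a ∉ W)

/-- Reachability by nontrivial paths on which only the ends may belong to `W`. -/
def Link (E : V → V → Prop) (W : Set V) (v t : V) : Prop := ∃ s, E v s ∧ FreeReach E W s t

theorem FreeReach.not_mem {E : V → V → Prop} {W : Set V} {a v : V} (h : FreeReach E W a v) :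
    a ∉ W ∨ a = v := by
  rcases ReflTransGen.cases_head h with h | ⟨c, h, -⟩
  · exact Or.inr h
  · exact Or.inl h.2

theorem FreeReach.eq_of_mem {E : V → V → Prop} {W : Set V} {a v : V} (h : FreeReach E W a v)
    (ha : a ∈ W) : a = v :=
  h.not_mem.resolve_left (not_not.2 ha)

theorem FreeReach.anti {E : V → V → Prop} {W W' : Set V} (hW : W ⊆ W') {a v : V}
    (h : FreeReach E W' a v) : FreeReach E W a v :=
  reflTransGen_of_imp (fun _ _ h => ⟨h.1, fun h' => h.2 (hW h')⟩) h

theorem exists_first_hit {E : V → V → Prop} {W Z : Set V} {x y : V} (h : FreeReach E W x y)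
    (hy : y ∈ Z) : ∃ z ∈ Z, FreeReach E (W ∪ Z) x z := by
  induction h using ReflTransGen.head_induction_on with
  | refl => exact ⟨y, hy, ReflTransGen.refl⟩
  | @head a c h1 _ ih =>
    by_cases ha : a ∈ Z
    · exact ⟨a, ha, ReflTransGen.refl⟩
    · obtain ⟨z, hz, h⟩ := ih
      exact ⟨z, hz, h.head ⟨h1.1, fun h' => h'.elim h1.2 ha⟩⟩

theorem exists_last_exit {E : V → V → Prop} {W : Set V} {x y : V} (h : FreeReach E W x y) :
    x = y ∨ Link E (insert x W) x y := by
  induction h with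
  | refl => exact Or.inl rfl
  | @tail b c _ h2 ih =>
    right
    by_cases hb : b = x
    · subst hb
      exact ⟨c, h2.1, ReflTransGen.refl⟩
    · obtain ⟨s, h1, h3⟩ := ih.resolve_left fun h => hb h.symm
      exact ⟨s, h1, h3.tail ⟨h2.1, fun h => h.elim hb h2.2⟩⟩

/-- The vertices between `x` and `y` on the paths of `FreeReach`. -/
def freeRegion (E : V → V → Prop) (W : Set V) (x y : V) : Set V :=
  {a | FreeReach E W x a ∧ FreeReach E W a y}

/-- The vertices between `v` and `t` on the paths of `Link`, and `v`. -/
def linkRegion (E : V → V → Prop) (W : Set V) (v t : V) : Set V :=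
  {a | a = v ∨ Link E W v a ∧ FreeReach E W a t}

section

variable {E : V → V → Prop} {W N J : Set V} {u : V}

theorem FreeReach.reachIn {x y : V} (h : FreeReach E W x y) :
    ReachIn (relabel E N u J) (freeRegion E W x y) x y :=
  (reachIn_between h).mono (fun _ _ _ _ h => Or.inl h.1) subset_rfl

theorem FreeReach.left_mem {x y : V} (h : FreeReach E W x y) : x ∈ freeRegion E W x y :=
  ⟨ReflTransGen.refl, h⟩

theorem FreeReach.right_mem {x y : V} (h : FreeReach E W x y) : y ∈ freeRegion E W x y :=
  ⟨h, ReflTransGen.refl⟩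

theorem left_mem_linkRegion {v t : V} : v ∈ linkRegion E W v t := Or.inl rfl

theorem Link.right_mem {v t : V} (h : Link E W v t) : t ∈ linkRegion E W v t :=
  Or.inr ⟨h, ReflTransGen.refl⟩

theorem Link.reachIn {v t : V} (h : Link E W v t) :
    ReachIn (relabel E N u J) (linkRegion E W v t) v t := by
  obtain ⟨s, h1, h2⟩ := h
  have hs : s ∈ linkRegion E W v t := Or.inr ⟨⟨s, h1, ReflTransGen.refl⟩, h2⟩
  have hvs : relabel E N u J v s := Or.inl h1
  have hsub : freeRegion E W s t ⊆ linkRegion E W v t :=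
    fun a ha => Or.inr ⟨⟨s, h1, ha.1⟩, ha.2⟩
  exact (ReachIn.single hvs left_mem_linkRegion hs).trans (h2.reachIn.mono_set hsub)

theorem freeRegion_mem {x y a : V} (h : a ∈ freeRegion E W x y) (ha : a ∈ W) : a = y :=
  h.2.eq_of_mem ha

theorem linkRegion_mem {v t a : V} (h : a ∈ linkRegion E W v t) (ha : a ∈ W) :
    a = v ∨ a = t :=
  h.imp_right fun h => h.2.eq_of_mem ha

/-- `E` is a digraph without arcs between `u` and `N` that becomes strongly connected if every
vertex of `N` is joined to `u` by an arc, directed towards `u` from the vertices of `J`. -/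
structure IsRooted (E : V → V → Prop) (N : Set V) (u : V) (J : Set V) : Prop where
  root_not_mem : u ∉ N
  irrefl_root : ¬ E u u
  root_left : ∀ v ∈ N, ¬ E u v
  root_right : ∀ v ∈ N, ¬ E v u
  strong : ∀ x y, ReflTransGen (relabel E N u J) x y

namespace IsRooted

theorem exists_to (h : IsRooted E N u J) {x : V} (hx : x ≠ u) :
    (∃ v ∈ N, FreeReach E (insert u N) x v) ∨
      ∃ z, E z u ∧ FreeReach E (insert u N) x z := by
  have key : x = u ∨ (∃ v ∈ N, FreeReach E (insert u N) x v) ∨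
      ∃ z, E z u ∧ FreeReach E (insert u N) x z := by
    induction h.strong x u using ReflTransGen.head_induction_on with
    | refl => exact Or.inl rfl
    | @head a b h1 _ ih =>
      by_cases hau : a = u
      · exact Or.inl hau
      right
      by_cases haN : a ∈ N
      · exact Or.inl ⟨a, haN, ReflTransGen.refl⟩
      have haW : a ∉ insert u N := fun h => h.elim hau haN
      have hab : E a b := by
        rcases h1 with h1 | h1 | h1
        · exact h1
        · exact absurd h1.1 haN
        · exact absurd h1.1 hau
      by_cases hbu : b = u
      · subst hbu
        exact Or.inr ⟨a, hab, ReflTransGen.refl⟩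
      rcases (ih hbu).resolve_left hbu with ⟨v, hv, h⟩ | ⟨z, hz, h⟩
      · exact Or.inl ⟨v, hv, h.head ⟨hab, haW⟩⟩
      · exact Or.inr ⟨z, hz, h.head ⟨hab, haW⟩⟩
  exact key.resolve_left hx

theorem exists_from (h : IsRooted E N u J) {y : V} (hy : y ≠ u) :
    (∃ v ∈ N, y = v ∨ Link E (insert u N) v y) ∨
      ∃ z, E u z ∧ FreeReach E (insert u N) z y := by
  have key : y = u ∨ (∃ v ∈ N, y = v ∨ Link E (insert u N) v y) ∨
      ∃ z, E u z ∧ FreeReach E (insert u N) z y := by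
    induction h.strong u y with
    | refl => exact Or.inl rfl
    | @tail a b _ h1 ih =>
      by_cases hbN : b ∈ N
      · exact Or.inr (Or.inl ⟨b, hbN, Or.inl rfl⟩)
      by_cases hbu : b = u
      · exact Or.inl hbu
      right
      have hab : E a b := by
        rcases h1 with h1 | h1 | h1
        · exact h1
        · exact absurd h1.2.2 hbu
        · exact absurd h1.2.1 hbN
      by_cases hau : a = u
      · subst hau
        exact Or.inr ⟨b, hab, ReflTransGen.refl⟩
      by_cases haN : a ∈ N
      · exact Or.inl ⟨a, haN, Or.inr ⟨b, hab, ReflTransGen.refl⟩⟩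
      have haW : a ∉ insert u N := fun h => h.elim hau haN
      rcases (ih hau).resolve_left hau with ⟨v, hv, rfl | ⟨s, hs, h⟩⟩ | ⟨z, hz, h⟩
      · exact absurd hv haN
      · exact Or.inl ⟨v, hv, Or.inr ⟨s, hs, h.tail ⟨hab, haW⟩⟩⟩
      · exact Or.inr ⟨z, hz, h.tail ⟨hab, haW⟩⟩
  exact key.resolve_left hy

/-- Otherwise `v` and the vertices linked from it form a set closed under the arcs: `v` has no arc
to `u` because `v ∉ J`, and the set contains neither another vertex of `N` nor an in-neighbor of
`u`. So `v` could not reach `u`. -/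
theorem exists_link_out (h : IsRooted E N u J) {v : V} (hv : v ∈ N) (hvJ : v ∉ J) :
    (∃ t ∈ N, t ≠ v ∧ Link E (insert u N) v t) ∨
      ∃ z, E z u ∧ Link E (insert u N) v z := by
  by_contra! hcon
  obtain ⟨h1, h2⟩ := hcon
  have hu : ¬ Link E (insert u N) v u := by
    rintro ⟨s, hs, hsu⟩
    rcases ReflTransGen.cases_tail hsu with rfl | ⟨c, hc, hcu⟩
    · exact h.root_right v hv hs
    · exact h2 c hcu.1 ⟨s, hs, hc⟩
  have key : ∀ b, ReflTransGen (relabel E N u J) v b → b = v ∨ Link E (insert u N) v b := by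
    intro b hb
    induction hb with
    | refl => exact Or.inl rfl
    | @tail a b _ hab ih =>
      right
      rcases ih with rfl | hva
      · rcases hab with hab | hab | hab
        · exact ⟨b, hab, ReflTransGen.refl⟩
        · exact absurd hab.2.1 hvJ
        · exact absurd (hab.1 ▸ hv) h.root_not_mem
      · by_cases hau : a = u
        · subst hau; exact absurd hva hu
        have hEab : a ∉ N → Link E (insert u N) v b := by
          intro haN
          have hab : E a b := by
            rcases hab with hab | hab | hab
            · exact hab
            · exact absurd hab.1 haN
            · exact absurd hab.1 hau
          obtain ⟨s, hs, hsa⟩ := hva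
          exact ⟨s, hs, hsa.tail ⟨hab, fun h => h.elim hau haN⟩⟩
        by_cases haN : a ∈ N
        · by_cases hav : a = v
          · subst hav
            rcases hab with hab | hab | hab
            · exact ⟨b, hab, ReflTransGen.refl⟩
            · exact absurd hab.2.1 hvJ
            · exact absurd hab.1 hau
          · exact absurd hva (h1 a haN hav)
        · exact hEab haN
  rcases key u (h.strong v u) with rfl | key
  · exact h.root_not_mem hv
  · exact hu key

/-- The same argument backwards: otherwise everything that reaches `v` does so freely, which fails
for `u`. -/
theorem exists_link_in (h : IsRooted E N u J) {v : V} (hv : v ∈ N) (hvJ : v ∈ J) :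
    (∃ t ∈ N, t ≠ v ∧ Link E (insert u N) t v) ∨
      ∃ z, E u z ∧ FreeReach E (insert u N) z v := by
  by_contra! hcon
  obtain ⟨h1, h2⟩ := hcon
  have key : ∀ a, ReflTransGen (relabel E N u J) a v → FreeReach E (insert u N) a v := by
    intro a ha
    induction ha using ReflTransGen.head_induction_on with
    | refl => exact ReflTransGen.refl
    | @head a b hab _ ih =>
      by_cases hbu : b = u
      · subst hbu
        have := ih.eq_of_mem (Set.mem_insert _ _)
        exact absurd (this ▸ hv) h.root_not_mem
      by_cases hau : a = u
      · subst hau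
        rcases hab with hab | hab | hab
        · exact absurd ih (h2 b hab)
        · exact absurd hab.1 h.root_not_mem
        · have := ih.eq_of_mem (Set.mem_insert_of_mem _ hab.2.1)
          exact absurd hvJ (this ▸ hab.2.2)
      have hEab : E a b := by
        rcases hab with hab | hab | hab
        · exact hab
        · exact absurd hab.2.2 hbu
        · exact absurd hab.1 hau
      by_cases hav : a = v
      · subst hav; exact ReflTransGen.refl
      by_cases haN : a ∈ N
      · exact absurd ⟨b, hEab, ih⟩ (h1 a haN hav)
      · exact ih.head ⟨hEab, fun h => h.elim hau haN⟩
  exact h.root_not_mem ((key u (h.strong u v)).eq_of_mem (Set.mem_insert _ _) ▸ hv)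

end IsRooted

end

theorem ncard_le_one_of_subset {S : Set V} {a : V} (h : S ⊆ {a}) : S.ncard ≤ 1 :=
  (Set.ncard_le_ncard h (Set.toFinite _)).trans (Set.ncard_singleton a).le

theorem ncard_le_two_of_subset {S : Set V} {a b : V} (h : S ⊆ {a, b}) : S.ncard ≤ 2 := by
  have h1 := Set.ncard_le_ncard h (Set.toFinite _)
  have h2 := Set.ncard_insert_le a {b}
  rw [Set.ncard_singleton] at h2
  omega

theorem ncard_le_three_of_subset {S : Set V} {a b c : V} (h : S ⊆ {a, b, c}) : S.ncard ≤ 3 := by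
  have h1 := Set.ncard_le_ncard h (Set.toFinite _)
  have h2 := Set.ncard_insert_le a {b, c}
  have h3 : ({b, c} : Set V).ncard ≤ 2 := ncard_le_two_of_subset subset_rfl
  omega

/-! ### Routes through the root for a one-step labelling. -/

section

variable {E : V → V → Prop} {N J J₀ : Set V} {u : V}

/-- The vertices of `N` that are reached from an out-neighbor of `u`. -/
def reachedSet (E : V → V → Prop) (N : Set V) (u : V) : Set V :=
  {v | v ∈ N ∧ ∃ z, E u z ∧ FreeReach E (insert u N) z v}

/-- The vertices of `N` that reach an in-neighbor of `u`. -/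
def reachingSet (E : V → V → Prop) (N : Set V) (u : V) : Set V :=
  {v | v ∈ N ∧ ∃ z, E z u ∧ Link E (insert u N) v z}

/-- No path from an out-neighbor of `u` to an in-neighbor of `u` avoids `N`, or there are two
in-neighbors. -/
def InSpread (E : V → V → Prop) (N : Set V) (u : V) : Prop :=
  (∃ a b, a ≠ b ∧ E a u ∧ E b u) ∨
    (∃ q, E q u) ∧ ∃ p, E u p ∧ ∀ q, E q u → ¬ FreeReach E (insert u N) p q

theorem relabel_to {v : V} (hv : v ∈ N) (hJ : v ∈ J) {P : Set V} (hP : v ∈ P) (hu : u ∈ P) :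
    ReachIn (relabel E N u J) P v u :=
  ReachIn.single (Or.inr (Or.inl ⟨hv, hJ, rfl⟩)) hP hu

theorem relabel_from {v : V} (hv : v ∈ N) (hJ : v ∉ J) {P : Set V} (hP : v ∈ P) (hu : u ∈ P) :
    ReachIn (relabel E N u J) P u v :=
  ReachIn.single (Or.inr (Or.inr ⟨rfl, hv, hJ⟩)) hu hP

theorem relabel_of_arc {a b : V} (h : E a b) {P : Set V} (hP : a ∈ P) (hu : b ∈ P) :
    ReachIn (relabel E N u J) P a b :=
  ReachIn.single (Or.inl h) hP hu

theorem IsRooted.ne_of_to (h : IsRooted E N u J₀) {z v : V} (hz : E z u) (hv : v ∈ N) : z ≠ v := by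
  rintro rfl; exact h.root_right _ hv hz

/-- From `x` go to the first vertex `v` of `N`. If `v` neither points to `u` nor reaches an
in-neighbor of `u`, one link leads to a vertex `t` that does. Only this last case meets `N` twice,
and then the region leaves out an end of an arc at `u`. -/
theorem IsRooted.exists_region_to (h : IsRooted E N u J₀) (hJ1 : reachedSet E N u ⊆ J)
    (hJ2 : ∀ v ∈ N, v ∉ J → v ∈ reachingSet E N u ∨ ∃ t ∈ N, Link E (insert u N) v t ∧
      (t ∈ J ∨ t ∈ reachingSet E N u)) (x : V) :
    ∃ P : Set V, x ∈ P ∧ u ∈ P ∧ ReachIn (relabel E N u J) P x u ∧ ((P ∩ N).ncard ≤ 1 ∨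
      (P ∩ N).ncard ≤ 2 ∧ (InSpread E N u → ∃ z, (E u z ∨ E z u) ∧ z ∉ P)) := by
  have huN := h.root_not_mem
  have hW : ∀ {v}, v ∈ N → v ∈ insert u N := fun hv => Or.inr hv
  by_cases hxu : x = u
  · subst hxu
    refine ⟨{x}, rfl, rfl, ReflTransGen.refl, Or.inl (ncard_le_one_of_subset
      Set.inter_subset_left)⟩
  by_cases hz : ∃ z, E z u ∧ FreeReach E (insert u N) x z
  · obtain ⟨z, hzu, hxz⟩ := hz
    refine ⟨freeRegion E (insert u N) x z ∪ {u}, Or.inl hxz.left_mem, Or.inr rfl,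
      (hxz.reachIn.mono_set Set.subset_union_left).trans
        (relabel_of_arc hzu (Or.inl hxz.right_mem) (Or.inr rfl)), Or.inl ?_⟩
    apply ncard_le_one_of_subset (a := z)
    rintro a ⟨ha | rfl, haN⟩
    · exact freeRegion_mem ha (hW haN)
    · exact absurd haN huN
  obtain ⟨v, hv, hxv⟩ := (h.exists_to hxu).resolve_right hz
  by_cases hvJ : v ∈ J
  · refine ⟨freeRegion E (insert u N) x v ∪ {u}, Or.inl hxv.left_mem, Or.inr rfl,
      (hxv.reachIn.mono_set Set.subset_union_left).trans
        (relabel_to hv hvJ (Or.inl hxv.right_mem) (Or.inr rfl)), Or.inl ?_⟩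
    apply ncard_le_one_of_subset (a := v)
    rintro a ⟨ha | rfl, haN⟩
    · exact freeRegion_mem ha (hW haN)
    · exact absurd haN huN
  by_cases hvm : v ∈ reachingSet E N u
  · obtain ⟨-, z, hzu, hvz⟩ := hvm
    refine ⟨freeRegion E (insert u N) x v ∪ linkRegion E (insert u N) v z ∪ {u},
      Or.inl (Or.inl hxv.left_mem), Or.inr rfl,
      (hxv.reachIn.mono_set ?_).trans ((hvz.reachIn.mono_set ?_).trans
        (relabel_of_arc hzu (Or.inl (Or.inr hvz.right_mem)) (Or.inr rfl))), Or.inl ?_⟩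
    · exact Set.subset_union_left.trans Set.subset_union_left
    · exact Set.subset_union_right.trans Set.subset_union_left
    apply ncard_le_one_of_subset (a := v)
    rintro a ⟨(ha | ha) | rfl, haN⟩
    · exact freeRegion_mem ha (hW haN)
    · exact (linkRegion_mem ha (hW haN)).resolve_right (h.ne_of_to hzu haN).symm
    · exact absurd haN huN
  obtain ⟨t, htN, hvt, ht⟩ := (hJ2 v hv hvJ).resolve_left hvm
  -- An in-neighbor of `u` met this early would have allowed a route already treated.
  have hto : ∀ z, E z u → z ∉ freeRegion E (insert u N) x v ∪ linkRegion E (insert u N) v t := by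
    rintro z hzu (ha | rfl | ha)
    · exact hz ⟨z, hzu, ha.1⟩
    · exact h.root_right _ hv hzu
    · exact hvm ⟨hv, z, hzu, ha.1⟩
  by_cases htJ : t ∈ J
  · refine ⟨freeRegion E (insert u N) x v ∪ linkRegion E (insert u N) v t ∪ {u},
      Or.inl (Or.inl hxv.left_mem), Or.inr rfl,
      (hxv.reachIn.mono_set ?_).trans ((hvt.reachIn.mono_set ?_).trans
        (relabel_to htN htJ (Or.inl (Or.inr hvt.right_mem)) (Or.inr rfl))), Or.inr ⟨?_, ?_⟩⟩
    · exact Set.subset_union_left.trans Set.subset_union_left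
    · exact Set.subset_union_right.trans Set.subset_union_left
    · apply ncard_le_two_of_subset (a := v) (b := t)
      rintro a ⟨(ha | ha) | rfl, haN⟩
      · exact Or.inl (freeRegion_mem ha (hW haN))
      · exact linkRegion_mem ha (hW haN)
      · exact absurd haN huN
    · intro hs
      obtain ⟨z, hzu⟩ : ∃ z, E z u := by
        rcases hs with ⟨a, -, -, ha, -⟩ | ⟨⟨q, hq⟩, -⟩
        · exact ⟨a, ha⟩
        · exact ⟨q, hq⟩
      refine ⟨z, Or.inr hzu, ?_⟩
      rintro (ha | rfl)
      · exact hto z hzu ha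
      · exact h.irrefl_root hzu
  obtain ⟨-, z₁, hz₁, s, hts, hsz⟩ := ht.resolve_left htJ
  -- Stopping at the first in-neighbor of `u` keeps all the others out of the region.
  obtain ⟨z, hzu : E z u, hsz⟩ := exists_first_hit (Z := {z | E z u}) hsz hz₁
  have htz : Link E (insert u N ∪ {z | E z u}) t z := ⟨s, hts, hsz⟩
  refine ⟨freeRegion E (insert u N) x v ∪ linkRegion E (insert u N) v t ∪
      (linkRegion E (insert u N ∪ {z | E z u}) t z ∪ {u}),
      Or.inl (Or.inl hxv.left_mem), Or.inr (Or.inr rfl),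
      (hxv.reachIn.mono_set ?_).trans ((hvt.reachIn.mono_set ?_).trans ((htz.reachIn.mono_set
        ?_).trans (relabel_of_arc hzu (Or.inr (Or.inl htz.right_mem)) (Or.inr (Or.inr rfl))))),
        Or.inr ⟨?_, ?_⟩⟩
  · exact Set.subset_union_left.trans Set.subset_union_left
  · exact Set.subset_union_right.trans Set.subset_union_left
  · exact Set.subset_union_left.trans Set.subset_union_right
  · apply ncard_le_two_of_subset (a := v) (b := t)
    rintro a ⟨(ha | ha) | ha | rfl, haN⟩
    · exact Or.inl (freeRegion_mem ha (hW haN))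
    · exact linkRegion_mem ha (hW haN)
    · exact Or.inr ((linkRegion_mem ha (Or.inl (hW haN))).resolve_right (h.ne_of_to hzu haN).symm)
    · exact absurd haN huN
  · intro hs
    rcases hs with ⟨a, b, hab, ha, hb⟩ | ⟨-, p, hp, hpq⟩
    · obtain ⟨c, hc, hcz⟩ : ∃ c, E c u ∧ c ≠ z := by
        by_cases haz : a = z
        · exact ⟨b, hb, fun h => hab (haz.trans h.symm)⟩
        · exact ⟨a, ha, haz⟩
      refine ⟨c, Or.inr hc, ?_⟩
      rintro (ha | ha | rfl)
      · exact hto c hc ha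
      · rcases linkRegion_mem ha (Or.inr hc) with hct | hcz'
        · exact h.root_right t htN (hct ▸ hc)
        · exact hcz hcz'
      · exact h.irrefl_root hc
    -- If `p` came before `v` or `t`, that vertex would be in `reachedSet`, hence in `J`; if it came
    -- after `t`, it would freely reach `z`.
    · refine ⟨p, Or.inl hp, ?_⟩
      rintro ((ha | rfl | ha) | (rfl | ha) | rfl)
      · exact hvJ (hJ1 ⟨hv, p, hp, ha.2⟩)
      · exact h.root_left _ hv hp
      · exact htJ (hJ1 ⟨htN, p, hp, ha.2⟩)
      · exact h.root_left _ htN hp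
      · exact hpq z hzu (ha.2.anti Set.subset_union_left)
      · exact h.irrefl_root hp

/-- The last vertex `w` of `N` before `y` is entered in one of the ways listed in `hJ2`. Only the
last way, through `v`, `t` and `w`, meets `N` three times, and it is used only when `y`, `w` and `t`
are not reached from out-neighbors of `u`; together with `v ∉ reachingSet E N u` this keeps all ends
of arcs at `u` off the route. -/
theorem IsRooted.exists_region_from (h : IsRooted E N u J₀)
    (hJ1 : ∀ v ∈ J, v ∈ reachingSet E N u → v ∈ reachedSet E N u) (hJN : J ⊆ N)
    (hJ2 : ∀ w ∈ J, w ∈ reachedSet E N u ∨ (∃ v ∈ N, v ∉ J ∧ Link E (insert u N) v w) ∨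
      (∃ t ∈ reachedSet E N u, Link E (insert u N) t w) ∨
      ∃ t ∈ J, t ∉ reachedSet E N u ∧ Link E (insert u N) t w ∧
        ∃ v ∈ N, v ∉ J ∧ v ∉ reachingSet E N u ∧ Link E (insert u N) v t) (y : V) :
    ∃ P : Set V, u ∈ P ∧ ReachIn (relabel E N u J) P u y ∧ ((P ∩ N).ncard ≤ 2 ∨
      (P ∩ N).ncard ≤ 3 ∧ ∀ z, (E u z ∨ E z u) → z ∉ P) := by
  have huN := h.root_not_mem
  have hW : ∀ {v}, v ∈ N → v ∈ insert u N := fun hv => Or.inr hv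
  by_cases hyu : y = u
  · subst hyu
    refine ⟨{y}, rfl, ReflTransGen.refl, Or.inl ((ncard_le_one_of_subset
      Set.inter_subset_left).trans (by norm_num))⟩
  by_cases hz : ∃ z, E u z ∧ FreeReach E (insert u N) z y
  · obtain ⟨z, hzu, hzy⟩ := hz
    refine ⟨{u} ∪ freeRegion E (insert u N) z y, Or.inl rfl,
      (relabel_of_arc hzu (Or.inl rfl) (Or.inr hzy.left_mem)).trans
        (hzy.reachIn.mono_set Set.subset_union_right), Or.inl
        (le_trans (b := 1) (ncard_le_one_of_subset (a := y) ?_) (by norm_num))⟩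
    rintro a ⟨rfl | ha, haN⟩
    · exact absurd haN huN
    · exact freeRegion_mem ha (hW haN)
  -- Taking `w = y` when `y ∈ N` ensures that the final portion meets `N` in `w` alone.
  obtain ⟨w, hw, hwy, hyN⟩ : ∃ w ∈ N, (y = w ∨ Link E (insert u N) w y) ∧ (y ∈ N → y = w) := by
    by_cases hyN : y ∈ N
    · exact ⟨y, hyN, Or.inl rfl, fun _ => rfl⟩
    · obtain ⟨w, hw, h⟩ := (h.exists_from hyu).resolve_right hz
      exact ⟨w, hw, h, fun h => absurd h hyN⟩
  set R := linkRegion E (insert u N) w y with hR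
  have hwR : w ∈ R := left_mem_linkRegion
  have hRr : ReachIn (relabel E N u J) R w y := by
    rcases hwy with rfl | hwy
    · exact ReflTransGen.refl
    · exact hwy.reachIn
  have hRN : ∀ a ∈ R, a ∈ N → a = w := by
    intro a ha haN
    rcases linkRegion_mem ha (hW haN) with rfl | rfl
    · rfl
    · exact hyN haN
  by_cases hwJ : w ∉ J
  · refine ⟨{u} ∪ R, Or.inl rfl, (relabel_from hw hwJ (Or.inr hwR) (Or.inl rfl)).trans
        (hRr.mono_set Set.subset_union_right), Or.inl
        (le_trans (b := 1) (ncard_le_one_of_subset (a := w) ?_) (by norm_num))⟩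
    rintro a ⟨rfl | ha, haN⟩
    · exact absurd haN huN
    · exact hRN a ha haN
  rw [not_not] at hwJ
  by_cases hwp : w ∈ reachedSet E N u
  · obtain ⟨-, z, hz, hzw⟩ := hwp
    refine ⟨{u} ∪ (freeRegion E (insert u N) z w ∪ R), Or.inl rfl,
      (relabel_of_arc hz (Or.inl rfl) (Or.inr (Or.inl hzw.left_mem))).trans
        ((hzw.reachIn.mono_set ?_).trans (hRr.mono_set ?_)), Or.inl
        (le_trans (b := 1) (ncard_le_one_of_subset (a := w) ?_) (by norm_num))⟩
    · exact Set.subset_union_left.trans Set.subset_union_right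
    · exact Set.subset_union_right.trans Set.subset_union_right
    rintro a ⟨rfl | ha | ha, haN⟩
    · exact absurd haN huN
    · exact freeRegion_mem ha (hW haN)
    · exact hRN a ha haN
  rcases (hJ2 w hwJ).resolve_left hwp with ⟨v, hv, hvJ, hvw⟩ | ⟨t, ⟨htN, z, hz, hzt⟩, htw⟩ |
    ⟨t, htJ, htp, htw, v, hv, hvJ, hvm, hvt⟩
  · refine ⟨{u} ∪ (linkRegion E (insert u N) v w ∪ R), Or.inl rfl,
      (relabel_from hv hvJ (Or.inr (Or.inl left_mem_linkRegion)) (Or.inl rfl)).trans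
        ((hvw.reachIn.mono_set ?_).trans (hRr.mono_set ?_)), Or.inl
        (ncard_le_two_of_subset (a := v) (b := w) ?_)⟩
    · exact Set.subset_union_left.trans Set.subset_union_right
    · exact Set.subset_union_right.trans Set.subset_union_right
    rintro a ⟨rfl | ha | ha, haN⟩
    · exact absurd haN huN
    · exact linkRegion_mem ha (hW haN)
    · exact Or.inr (hRN a ha haN)
  · refine ⟨{u} ∪ (freeRegion E (insert u N) z t ∪ (linkRegion E (insert u N) t w ∪ R)),
      Or.inl rfl, (relabel_of_arc hz (Or.inl rfl) (Or.inr (Or.inl hzt.left_mem))).trans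
        ((hzt.reachIn.mono_set ?_).trans ((htw.reachIn.mono_set ?_).trans (hRr.mono_set ?_))),
        Or.inl (ncard_le_two_of_subset (a := t) (b := w) ?_)⟩
    · exact Set.subset_union_left.trans Set.subset_union_right
    · exact Set.subset_union_left.trans (Set.subset_union_right.trans Set.subset_union_right)
    · exact Set.subset_union_right.trans (Set.subset_union_right.trans Set.subset_union_right)
    rintro a ⟨rfl | ha | ha | ha, haN⟩
    · exact absurd haN huN
    · exact Or.inl (freeRegion_mem ha (hW haN))
    · exact linkRegion_mem ha (hW haN)
    · exact Or.inr (hRN a ha haN)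
  · have htN : t ∈ N := hJN htJ
    refine ⟨{u} ∪ (linkRegion E (insert u N) v t ∪ (linkRegion E (insert u N) t w ∪ R)),
      Or.inl rfl,
      (relabel_from hv hvJ (Or.inr (Or.inl left_mem_linkRegion)) (Or.inl rfl)).trans
        ((hvt.reachIn.mono_set ?_).trans ((htw.reachIn.mono_set ?_).trans (hRr.mono_set ?_))),
        Or.inr ⟨ncard_le_three_of_subset (a := v) (b := t) (c := w) ?_, ?_⟩⟩
    · exact Set.subset_union_left.trans Set.subset_union_right
    · exact Set.subset_union_left.trans (Set.subset_union_right.trans Set.subset_union_right)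
    · exact Set.subset_union_right.trans (Set.subset_union_right.trans Set.subset_union_right)
    · rintro a ⟨rfl | ha | ha | ha, haN⟩
      · exact absurd haN huN
      · rcases linkRegion_mem ha (hW haN) with ha | ha
        · exact Or.inl ha
        · exact Or.inr (Or.inl ha)
      · exact Or.inr (linkRegion_mem ha (hW haN))
      · exact Or.inr (Or.inr (hRN a ha haN))
    · rintro z hzz (rfl | (rfl | ha) | (rfl | ha) | (rfl | ha))
      · exact hzz.elim h.irrefl_root h.irrefl_root
      · exact hzz.elim (h.root_left _ hv) (h.root_right _ hv)
      · rcases hzz with hz' | hz'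
        · exact htp ⟨htN, z, hz', ha.2⟩
        · exact hvm ⟨hv, z, hz', ha.1⟩
      · exact hzz.elim (h.root_left _ htN) (h.root_right _ htN)
      · rcases hzz with hz' | hz'
        · exact hwp ⟨hw, z, hz', ha.2⟩
        · exact htp (hJ1 t htJ ⟨htN, z, hz', ha.1⟩)
      · exact hzz.elim (h.root_left _ hw) (h.root_right _ hw)
      · rcases hzz with hz' | hz'
        · exact hz ⟨z, hz', ha.2⟩
        · exact hwp (hJ1 w hwJ ⟨hw, z, hz', ha.1⟩)

/-- The neighbors of `u` in `E`. -/
def arcNeighbors (E : V → V → Prop) (u : V) : Set V := {z | E u z ∨ E z u}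

theorem IsRooted.exists_relabel_spread [Finite V] (h : IsRooted E N u J₀) :
    ∃ J, ∀ x y, ∃ S, x ∈ S ∧ ReachIn (relabel E N u J) S x y ∧ (S ∩ N).ncard ≤ 5 ∧
      (InSpread E N u →
        (S ∩ (N ∪ arcNeighbors E u)).ncard ≤ (arcNeighbors E u).ncard + 4) := by
  obtain ⟨J, hJN, hJ1, hJ2, hJ3, hJ4⟩ := exists_absorbing
    (L := fun v t => v ∈ N ∧ t ∈ N ∧ t ≠ v ∧ Link E (insert u N) v t) (fun v h => h.2.2.1 rfl)
    (N := N) (Xp := reachedSet E N u) (Xm := reachingSet E N u) (fun v t h => ⟨h.1, h.2.1⟩)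
    (fun v hv => hv.1) (by
      intro v hv
      by_cases hvJ : v ∈ J₀
      · rcases h.exists_link_in hv hvJ with ⟨t, htN, htv, h⟩ | h
        · exact Or.inr (Or.inr (Or.inl ⟨t, htN, hv, htv.symm, h⟩))
        · exact Or.inl ⟨hv, h⟩
      · rcases h.exists_link_out hv hvJ with ⟨t, htN, htv, h⟩ | h
        · exact Or.inr (Or.inr (Or.inr ⟨t, hv, htN, htv, h⟩))
        · exact Or.inr (Or.inl ⟨hv, h⟩))
  refine ⟨J, fun x y => ?_⟩
  obtain ⟨P, hxP, huP, hP, hPc⟩ := h.exists_region_to hJ1 (fun v hv hvJ =>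
    (hJ3 v hv hvJ).imp_right fun ⟨t, h, h'⟩ => ⟨t, h.2.1, h.2.2.2, h'⟩) x
  obtain ⟨Q, huQ, hQ, hQc⟩ := h.exists_region_from (J := J) hJ2 hJN (by
    intro w hw
    rcases hJ4 w hw with h | ⟨v, h1, h2⟩ | ⟨t, h1, h2⟩ | ⟨t, h1, h2, h3, v, h4, h5, h6⟩
    · exact Or.inl h
    · exact Or.inr (Or.inl ⟨v, h2.1, h1, h2.2.2.2⟩)
    · exact Or.inr (Or.inr (Or.inl ⟨t, h1, h2.2.2.2⟩))
    · exact Or.inr (Or.inr (Or.inr ⟨t, h1, h2, h3.2.2.2, v, h6.1, h4, h5, h6.2.2.2⟩))) y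
  refine ⟨P ∪ Q, Or.inl hxP, (hP.mono_set Set.subset_union_left).trans
    (hQ.mono_set Set.subset_union_right), ?_, fun hs => ?_⟩
  · have h1 := Set.ncard_union_le (P ∩ N) (Q ∩ N)
    rw [Set.union_inter_distrib_right]
    have hP2 : (P ∩ N).ncard ≤ 2 := by rcases hPc with h | h <;> omega
    have hQ2 : (Q ∩ N).ncard ≤ 3 := by rcases hQc with h | h <;> omega
    omega
  · have h1 := Set.ncard_union_le (P ∩ N) (Q ∩ N)
    have h2 := Set.ncard_union_le ((P ∪ Q) ∩ N) ((P ∪ Q) ∩ arcNeighbors E u)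
    rw [← Set.inter_union_distrib_left, Set.union_inter_distrib_right P Q N] at h2
    have h3 : ((P ∪ Q) ∩ arcNeighbors E u).ncard ≤ (arcNeighbors E u).ncard :=
      Set.ncard_le_ncard Set.inter_subset_right (Set.toFinite _)
    -- Five vertices of `N` occur only as 2 + 3. Then `Q` avoids all ends of arcs at `u` and `P`
    -- avoids one of them, which makes up for the fifth vertex.
    have key : (P ∩ N).ncard + (Q ∩ N).ncard ≤ 4 ∨ (P ∩ N).ncard + (Q ∩ N).ncard ≤ 5 ∧
        ((P ∪ Q) ∩ arcNeighbors E u).ncard < (arcNeighbors E u).ncard := by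
      rcases hPc with hPc | ⟨hPc, hPz⟩
      · left; rcases hQc with h | h <;> omega
      rcases hQc with hQc | ⟨hQc, hQz⟩
      · left; omega
      right
      refine ⟨by omega, Set.ncard_lt_ncard ⟨Set.inter_subset_right, fun hsub => ?_⟩
        (Set.toFinite _)⟩
      obtain ⟨z, hz, hzP⟩ := hPz hs
      exact (hsub hz).1.elim hzP (hQz z hz)
    rcases key with h | h <;> omega

/-! ### Reversal, and the case of one arc into and one arc out of the root. -/

theorem relabel_flip {a b : V} :
    relabel (fun a b => E b a) N u (N \ J) b a ↔ relabel E N u J a b := by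
  unfold relabel
  simp only [Set.mem_sdiff]
  tauto

theorem IsRooted.flip (h : IsRooted E N u J) : IsRooted (fun a b => E b a) N u (N \ J) where
  root_not_mem := h.root_not_mem
  irrefl_root := h.irrefl_root
  root_left := h.root_right
  root_right := h.root_left
  strong x y := reflTransGen_of_imp (fun _ _ h => relabel_flip.2 h) (reflTransGen_flip (h.strong y x))

theorem IsRooted.exists_region_two_step (h : IsRooted E N u J₀) (hE : ∀ z, ¬ E z u)
    (hJ : ∀ v ∈ N, v ∉ J → ∃ t ∈ N, Link E (insert u N) v t ∧
      (t ∈ J ∨ ∃ t' ∈ N, Link E (insert u N) t t' ∧ t' ∈ J)) (x : V) :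
    ∃ P : Set V, x ∈ P ∧ u ∈ P ∧ ReachIn (relabel E N u J) P x u ∧ (P ∩ N).ncard ≤ 3 := by
  have huN := h.root_not_mem
  have hW : ∀ {v}, v ∈ N → v ∈ insert u N := fun hv => Or.inr hv
  by_cases hxu : x = u
  · subst hxu
    exact ⟨{x}, rfl, rfl, ReflTransGen.refl, (ncard_le_one_of_subset
      Set.inter_subset_left).trans (by norm_num)⟩
  obtain ⟨v, hv, hxv⟩ := (h.exists_to hxu).resolve_right fun ⟨z, hz, _⟩ => hE z hz
  by_cases hvJ : v ∈ J
  · refine ⟨freeRegion E (insert u N) x v ∪ {u}, Or.inl hxv.left_mem, Or.inr rfl,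
      (hxv.reachIn.mono_set Set.subset_union_left).trans
        (relabel_to hv hvJ (Or.inl hxv.right_mem) (Or.inr rfl)),
      ncard_le_three_of_subset (a := v) (b := v) (c := v) ?_⟩
    rintro a ⟨ha | rfl, haN⟩
    · exact Or.inl (freeRegion_mem ha (hW haN))
    · exact absurd haN huN
  obtain ⟨t, ht, hvt, h'⟩ := hJ v hv hvJ
  by_cases htJ : t ∈ J
  · refine ⟨freeRegion E (insert u N) x v ∪ linkRegion E (insert u N) v t ∪ {u},
      Or.inl (Or.inl hxv.left_mem), Or.inr rfl,
      (hxv.reachIn.mono_set ?_).trans ((hvt.reachIn.mono_set ?_).trans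
        (relabel_to ht htJ (Or.inl (Or.inr hvt.right_mem)) (Or.inr rfl))),
      ncard_le_three_of_subset (a := v) (b := v) (c := t) ?_⟩
    · exact Set.subset_union_left.trans Set.subset_union_left
    · exact Set.subset_union_right.trans Set.subset_union_left
    · rintro a ⟨(ha | ha) | rfl, haN⟩
      · exact Or.inl (freeRegion_mem ha (hW haN))
      · exact Or.inr (linkRegion_mem ha (hW haN))
      · exact absurd haN huN
  obtain ⟨r, hr, htr, hrJ⟩ := h'.resolve_left htJ
  refine ⟨freeRegion E (insert u N) x v ∪ linkRegion E (insert u N) v t ∪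
      (linkRegion E (insert u N) t r ∪ {u}),
      Or.inl (Or.inl hxv.left_mem), Or.inr (Or.inr rfl),
      (hxv.reachIn.mono_set ?_).trans ((hvt.reachIn.mono_set ?_).trans ((htr.reachIn.mono_set
        ?_).trans (relabel_to hr hrJ (Or.inr (Or.inl htr.right_mem)) (Or.inr (Or.inr rfl))))),
      ncard_le_three_of_subset (a := v) (b := t) (c := r) ?_⟩
  · exact Set.subset_union_left.trans Set.subset_union_left
  · exact Set.subset_union_right.trans Set.subset_union_left
  · exact Set.subset_union_left.trans Set.subset_union_right
  · rintro a ⟨(ha | ha) | ha | rfl, haN⟩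
    · exact Or.inl (freeRegion_mem ha (hW haN))
    · rcases linkRegion_mem ha (hW haN) with ha | ha
      · exact Or.inl ha
      · exact Or.inr (Or.inl ha)
    · exact Or.inr (linkRegion_mem ha (hW haN))
    · exact absurd haN huN

theorem Link.flip {W : Set V} {v t : V} (h : Link E W v t) :
    Link (fun a b => E b a) W t v := by
  obtain ⟨s, hvs, hst⟩ := h
  induction hst with
  | refl => exact ⟨v, hvs, ReflTransGen.refl⟩
  | @tail b c _ hbc ih =>
    obtain ⟨d, hdb, hd⟩ := ih
    exact ⟨b, hbc.1, hd.head ⟨hdb, hbc.2⟩⟩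

/-- The two halves of the labelling condition are exchanged by reversing all arcs and complementing
`J`, so `exists_region_two_step` serves both directions: 3 + 3 vertices of `N`. -/
theorem IsRooted.exists_relabel_two_step [Finite V] (h : IsRooted E N u J₀)
    (hE : ∀ z, ¬ E z u ∧ ¬ E u z) {p q : V} (hp : p ∈ N) (hq : q ∈ N) (hpq : p ≠ q)
    (hlink : Link E (insert u N) p q) :
    ∃ J, p ∉ J ∧ q ∈ J ∧ ∀ x y, ∃ S, x ∈ S ∧ ReachIn (relabel E N u J) S x y ∧
      (S ∩ N).ncard ≤ 6 := by
  obtain ⟨J, hpJ, hqJ, hJ1, hJ2⟩ := exists_two_step_absorbing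
    (L := fun v t => v ∈ N ∧ t ∈ N ∧ t ≠ v ∧ Link E (insert u N) v t) (fun v h => h.2.2.1 rfl)
    (N := N) (by
      intro v hv
      by_cases hvJ : v ∈ J₀
      · rcases h.exists_link_in hv hvJ with ⟨t, htN, htv, h⟩ | ⟨z, hz, -⟩
        · exact Or.inl ⟨t, htN, hv, htv.symm, h⟩
        · exact absurd hz (hE z).2
      · rcases h.exists_link_out hv hvJ with ⟨t, htN, htv, h⟩ | ⟨z, hz, -⟩
        · exact Or.inr ⟨t, hv, htN, htv, h⟩
        · exact absurd hz (hE z).1) (p := p) (q := q) ⟨hp, hq, hpq.symm, hlink⟩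
  refine ⟨J, hpJ, hqJ, fun x y => ?_⟩
  obtain ⟨P, hxP, huP, hP, hPc⟩ := h.exists_region_two_step (J := J) (fun z => (hE z).1) (by
    intro v hv hvJ
    obtain ⟨t, ht, h'⟩ := hJ1 v hv hvJ
    exact ⟨t, ht.2.1, ht.2.2.2, h'.imp_right fun ⟨r, hr, hrJ⟩ => ⟨r, hr.2.1, hr.2.2.2, hrJ⟩⟩) x
  obtain ⟨Q, hyQ, huQ, hQ, hQc⟩ := h.flip.exists_region_two_step (J := N \ J)
    (fun z => (hE z).2) (by
      intro v hv hvJ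
      obtain ⟨t, ht, h'⟩ := hJ2 v (by_contra fun h => hvJ ⟨hv, h⟩)
      exact ⟨t, ht.1, ht.2.2.2.flip, h'.imp (fun h => ⟨ht.1, h⟩)
        fun ⟨r, hr, hrJ⟩ => ⟨r, hr.1, hr.2.2.2.flip, hr.1, hrJ⟩⟩) y
  refine ⟨P ∪ Q, Or.inl hxP, (hP.mono_set Set.subset_union_left).trans
    ((hQ.swap.mono (fun a b _ _ h => relabel_flip.1 h) Set.subset_union_right)), ?_⟩
  rw [Set.union_inter_distrib_right]
  have := Set.ncard_union_le (P ∩ N) (Q ∩ N)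
  omega

end

theorem FreeReach.congr_of_root {E : V → V → Prop} {W W' : Set V} {u s q : V}
    (h : FreeReach E W s q) (hW : W' ⊆ W) (hu : u ∈ W) (hq : q ≠ u) :
    FreeReach (fun a b => E a b ∧ a ≠ u ∧ b ≠ u) W' s q := by
  induction h using ReflTransGen.head_induction_on with
  | refl => exact ReflTransGen.refl
  | @head a b h1 h2 ih =>
    refine ih.head ⟨⟨h1.1, ?_, ?_⟩, fun h => h1.2 (hW h)⟩
    · rintro rfl; exact h1.2 hu
    · rintro rfl; exact hq (FreeReach.eq_of_mem h2 hu).symm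

theorem IsRooted.exists_relabel_of_two_le [Finite V] {E : V → V → Prop} {N J₀ : Set V} {u : V}
    (h : IsRooted E N u J₀) (hN : ∀ a b, E a b → ¬ E b a)
    (hJout : ∀ z, E u z → z ∉ J₀) (hJin : ∀ z, E z u → z ∈ J₀)
    (h2 : 2 ≤ {z | E u z}.ncard + {z | E z u}.ncard) :
    ∃ J, ∀ x y, ∃ S, x ∈ S ∧ ReachIn (relabel E N u J) S x y ∧
      (S ∩ (N ∪ arcNeighbors E u)).ncard ≤ (arcNeighbors E u).ncard + 4 := by
  by_cases hs : InSpread E N u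
  · obtain ⟨J, hJ⟩ := h.exists_relabel_spread
    refine ⟨J, fun x y => ?_⟩
    obtain ⟨S, h1, h3, -, h4⟩ := hJ x y
    exact ⟨S, h1, h3, h4 hs⟩
  by_cases hs' : InSpread (fun a b => E b a) N u
  · obtain ⟨J, hJ⟩ := h.flip.exists_relabel_spread
    refine ⟨N \ J, fun x y => ?_⟩
    obtain ⟨S, h1, h3, -, h4⟩ := hJ y x
    have h3' : ReachIn (relabel E N u (N \ J)) S x y :=
      h3.swap.mono (fun a b _ _ h => (relabel_flip (E := fun a b => E b a)).2 h) subset_rfl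
    have hflip : arcNeighbors (fun a b => E b a) u = arcNeighbors E u := by
      ext z; exact Or.comm
    -- The reversed statement puts `y` in `S`; a nontrivial path inside `S` puts `x` there too.
    by_cases hxy : x = y
    · subst hxy
      exact ⟨S, h1, h3', hflip ▸ h4 hs'⟩
    · refine ⟨S, ?_, h3', hflip ▸ h4 hs'⟩
      rcases ReflTransGen.cases_head h3' with h | ⟨c, hc, -⟩
      · exact absurd h hxy
      · exact hc.2.1
  have hin : {z | E z u}.ncard ≤ 1 := by
    by_contra! hlt
    obtain ⟨a, ha, b, hb, hab⟩ := (Set.one_lt_ncard (Set.toFinite _)).1 hlt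
    exact hs (Or.inl ⟨a, b, hab, ha, hb⟩)
  have hout : {z | E u z}.ncard ≤ 1 := by
    by_contra! hlt
    obtain ⟨a, ha, b, hb, hab⟩ := (Set.one_lt_ncard (Set.toFinite _)).1 hlt
    exact hs' (Or.inl ⟨a, b, hab, ha, hb⟩)
  obtain ⟨q, hq⟩ := Set.ncard_eq_one.1 (show {z | E z u}.ncard = 1 by omega)
  obtain ⟨p, hp⟩ := Set.ncard_eq_one.1 (show {z | E u z}.ncard = 1 by omega)
  have hq' : ∀ z, E z u ↔ z = q := fun z => Set.ext_iff.1 hq z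
  have hp' : ∀ z, E u z ↔ z = p := fun z => Set.ext_iff.1 hp z
  have hqu : E q u := (hq' q).2 rfl
  have hup : E u p := (hp' p).2 rfl
  have hpq : p ≠ q := by rintro rfl; exact hN _ _ hup hqu
  have hfree : FreeReach E (insert u N) p q := by
    by_contra hn
    exact hs (Or.inr ⟨⟨q, hqu⟩, p, hup, fun z hz => (hq' z).1 hz ▸ hn⟩)
  have hpu : p ≠ u := by rintro rfl; exact h.irrefl_root hup
  have hqne : q ≠ u := by rintro rfl; exact h.irrefl_root hqu
  -- The arcs from `u` to `p` and from `q` to `u` are treated as redirectable edges whose labels `p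
  -- ∉ J`, `q ∈ J` reproduce their true directions.
  set N' : Set V := insert p (insert q N) with hN'
  have hpN' : p ∈ N' := Or.inl rfl
  have hqN' : q ∈ N' := Or.inr (Or.inl rfl)
  have huN' : u ∉ N' := by
    rintro (h' | h' | h')
    · exact hpu h'.symm
    · exact hqne h'.symm
    · exact h.root_not_mem h'
  have hrel : ∀ J : Set V, p ∉ J → q ∈ J → ∀ a b,
      relabel (fun a b => E a b ∧ a ≠ u ∧ b ≠ u) N' u J a b → relabel E N u J a b := by
    rintro J hpJ hqJ a b (h' | ⟨rfl | rfl | h', ha, rfl⟩ | ⟨rfl, rfl | rfl | h', hb⟩)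
    · exact Or.inl h'.1
    · exact absurd ha hpJ
    · exact Or.inl hqu
    · exact Or.inr (Or.inl ⟨h', ha, rfl⟩)
    · exact Or.inl hup
    · exact absurd hqJ hb
    · exact Or.inr (Or.inr ⟨rfl, h', hb⟩)
  have hroot : IsRooted (fun a b => E a b ∧ a ≠ u ∧ b ≠ u) N' u J₀ := by
    refine ⟨huN', fun h => h.2.1 rfl, fun v _ h => h.2.1 rfl, fun v _ h => h.2.2 rfl,
      fun x y => reflTransGen_of_imp ?_ (h.strong x y)⟩
    rintro a b (h' | ⟨ha, haJ, rfl⟩ | ⟨rfl, hb, hbJ⟩)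
    · by_cases hau : a = u
      · subst hau
        rw [hp'] at h'
        subst h'
        exact Or.inr (Or.inr ⟨rfl, hpN', hJout _ hup⟩)
      by_cases hbu : b = u
      · subst hbu
        rw [hq'] at h'
        subst h'
        exact Or.inr (Or.inl ⟨hqN', hJin _ hqu, rfl⟩)
      exact Or.inl ⟨h', hau, hbu⟩
    · exact Or.inr (Or.inl ⟨Or.inr (Or.inr ha), haJ, rfl⟩)
    · exact Or.inr (Or.inr ⟨rfl, Or.inr (Or.inr hb), hbJ⟩)
  have hlink : Link (fun a b => E a b ∧ a ≠ u ∧ b ≠ u) (insert u N') p q := by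
    -- A link must avoid `p` and `q` inside, so the path is cut at its last visit to `p` and then at
    -- its first visit to `q`.
    obtain ⟨s, hps, hsq⟩ := (exists_last_exit hfree).resolve_left hpq
    obtain ⟨z, rfl, hsz⟩ := exists_first_hit (Z := {q}) hsq rfl
    have huW : u ∈ insert p (insert u N) ∪ {z} := Or.inl (Or.inr (Or.inl rfl))
    refine ⟨s, ⟨hps, hpu, ?_⟩, hsz.congr_of_root ?_ huW hqne⟩
    · rintro rfl
      exact hqne (hsz.eq_of_mem huW).symm
    · rintro a (rfl | rfl | rfl | ha)
      · exact huW
      · exact Or.inl (Or.inl rfl)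
      · exact Or.inr rfl
      · exact Or.inl (Or.inr (Or.inr ha))
  obtain ⟨J, hpJ, hqJ, hJ⟩ := hroot.exists_relabel_two_step
    (fun z => ⟨fun h => h.2.2 rfl, fun h => h.2.1 rfl⟩) hpN' hqN' hpq hlink
  refine ⟨J, fun x y => ?_⟩
  obtain ⟨S, h1, h3, h4⟩ := hJ x y
  refine ⟨S, h1, h3.mono (fun a b _ _ h => hrel J hpJ hqJ a b h) subset_rfl, ?_⟩
  have harc : arcNeighbors E u = {p, q} := by
    ext z
    change E u z ∨ E z u ↔ z = p ∨ z = q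
    rw [hp', hq']
  have hun : N ∪ arcNeighbors E u = N' := by
    rw [harc, hN']
    ext z
    simp only [Set.mem_union, Set.mem_insert_iff, Set.mem_singleton_iff]
    tauto
  rw [hun, harc, Set.ncard_pair hpq]
  exact h4

/-! ### The bounds for mixed graphs. -/

/-- The arcs of `D` except those between `u` and `N`. -/
def arcsOff (D : MixedGraph V) (N : Set V) (u : V) (a b : V) : Prop :=
  D.arc a b ∧ ¬ (a = u ∧ b ∈ N) ∧ ¬ (a ∈ N ∧ b = u)

theorem IsStrongOrientation.isRooted {G D : MixedGraph V} (hD : D.IsStrongOrientation G) (u : V) :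
    IsRooted (D.arcsOff (G.undirNeighbors u) u) (G.undirNeighbors u) u {v | D.arc v u} where
  root_not_mem h := G.edges.loopless.irrefl u h
  irrefl_root h := D.arc_irrefl u h.1
  root_left v hv h := h.2.1 ⟨rfl, hv⟩
  root_right v hv h := h.2.2 ⟨hv, rfl⟩
  strong x y := by
    refine reflTransGen_of_imp ?_ (isConnected_iff.1 hD.2 x y)
    intro a b hab
    have hab : D.arc a b := hab.resolve_left (hD.1.1 a b)
    by_cases h1 : a = u ∧ b ∈ G.undirNeighbors u
    · exact Or.inr (Or.inr ⟨h1.1, h1.2, fun h => D.arc_asymm _ _ hab (h1.1 ▸ h)⟩)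
    by_cases h2 : a ∈ G.undirNeighbors u ∧ b = u
    · obtain ⟨h2, rfl⟩ := h2
      exact Or.inr (Or.inl ⟨h2, hab, rfl⟩)
    exact Or.inl ⟨hab, h1, h2⟩

theorem IsOrientation.isBipartiteWith {G D : MixedGraph V} (hD : D.IsOrientation G)
    {A B : Set V} (hAB : G.IsBipartiteWith A B) : D.IsBipartiteWith A B :=
  ⟨hAB.1, hAB.2.1, fun x y h => hAB.2.2 x y (hD.2.2.2 x y (h.resolve_left (hD.1 x y)))⟩

/-- Relabelling reverses only undirected edges of `G` at `u`, so the result still orients `G`;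
strength is exactly `hJ`. -/
theorem IsStrongOrientation.exists_relabel {G D : MixedGraph V} (hD : D.IsStrongOrientation G)
    {u : V} {J : Set V} (hJ : ∀ x y, ReflTransGen
      (relabel (D.arcsOff (G.undirNeighbors u) u) (G.undirNeighbors u) u J) x y) :
    ∃ D' : MixedGraph V, D'.IsStrongOrientation G ∧ ∀ a b,
      relabel (D.arcsOff (G.undirNeighbors u) u) (G.undirNeighbors u) u J a b → D'.Step a b := by
  set N := G.undirNeighbors u with hN
  have huN : u ∉ N := fun h => G.edges.loopless.irrefl u h
  have hF : ∀ a b, relabel (D.arcsOff N u) N u J a b → ¬ relabel (D.arcsOff N u) N u J b a := by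
    rintro a b (⟨h1, h2, h3⟩ | ⟨h1, h2, h3⟩ | ⟨h1, h2, h3⟩) (⟨k1, k2, k3⟩ | ⟨k1, k2, k3⟩ | ⟨k1, k2, k3⟩)
    · exact D.arc_asymm _ _ h1 k1
    · exact h2 ⟨k3, k1⟩
    · exact h3 ⟨k2, k1⟩
    · exact k2 ⟨h3, h1⟩
    · exact huN (h3 ▸ k1)
    · exact k3 h2
    · exact k3 ⟨h2, h1⟩
    · exact h3 k2
    · exact huN (h1 ▸ k2)
  have harc : ∀ a b, relabel (D.arcsOff N u) N u J a b → (G.orientBy _ hF).arc a b := by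
    intro a b h
    have hG : G.edges.Adj a b ∨ G.arc a b := by
      rcases h with h | ⟨h1, -, rfl⟩ | ⟨rfl, h1, -⟩
      · exact hD.1.2.2.2 a b h.1
      · exact Or.inl (SimpleGraph.Adj.symm h1)
      · exact Or.inl h1
    exact hG.symm.imp_right fun hG => ⟨hG, h⟩
  refine ⟨G.orientBy _ hF, ⟨⟨?_, fun _ _ h => Or.inl h, ?_, ?_⟩, ?_⟩, fun a b h => Or.inr (harc a b h)⟩
  · have cover : ∀ a b, G.edges.Adj a b → D.arc a b →
        relabel (D.arcsOff N u) N u J a b ∨ relabel (D.arcsOff N u) N u J b a := by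
      intro a b hadj hab
      by_cases h1 : a = u ∧ b ∈ N
      · by_cases hb : b ∈ J
        · exact Or.inr (Or.inr (Or.inl ⟨h1.2, hb, h1.1⟩))
        · exact Or.inl (Or.inr (Or.inr ⟨h1.1, h1.2, hb⟩))
      by_cases h2 : a ∈ N ∧ b = u
      · by_cases hb : a ∈ J
        · exact Or.inl (Or.inr (Or.inl ⟨h2.1, hb, h2.2⟩))
        · exact Or.inr (Or.inr (Or.inr ⟨h2.2, h2.1, hb⟩))
      exact Or.inl (Or.inl ⟨hab, h1, h2⟩)
    rintro a b ⟨h1, h2, h3⟩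
    rcases hD.1.2.2.1 a b h1 with h | h
    · exact (cover a b h1 h).elim h2 h3
    · exact (cover b a h1.symm h).elim h3 h2
  · intro x y h
    rcases hD.1.2.2.1 x y h with h' | h'
    · by_cases hr : relabel (D.arcsOff N u) N u J x y
      · exact Or.inl (harc _ _ hr)
      · refine Or.inr (harc _ _ ?_)
        by_cases h1 : x = u ∧ y ∈ N
        · refine Or.inr (Or.inl ⟨h1.2, by_contra fun hy => hr (Or.inr (Or.inr ⟨h1.1, h1.2, hy⟩)), h1.1⟩)
        by_cases h2 : x ∈ N ∧ y = u
        · exact Or.inr (Or.inr ⟨h2.2, h2.1, fun hx => hr (Or.inr (Or.inl ⟨h2.1, hx, h2.2⟩))⟩)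
        exact absurd (Or.inl ⟨h', h1, h2⟩) hr
    · by_cases hr : relabel (D.arcsOff N u) N u J y x
      · exact Or.inr (harc _ _ hr)
      · refine Or.inl (harc _ _ ?_)
        by_cases h1 : y = u ∧ x ∈ N
        · refine Or.inr (Or.inl ⟨h1.2, by_contra fun hy => hr (Or.inr (Or.inr ⟨h1.1, h1.2, hy⟩)), h1.1⟩)
        by_cases h2 : y ∈ N ∧ x = u
        · exact Or.inr (Or.inr ⟨h2.2, h2.1, fun hx => hr (Or.inr (Or.inl ⟨h2.1, hx, h2.2⟩))⟩)
        exact absurd (Or.inl ⟨h', h1, h2⟩) hr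
  · rintro x y (h | h)
    · exact Or.inr h
    · exact Or.inl h.1
  · exact isConnected_iff.2 fun x y =>
      reflTransGen_of_imp (fun a b h => Or.inr (harc a b h)) (hJ x y)

theorem IsBipartiteWith.mem_left {G : MixedGraph V} {A B : Set V} (hAB : G.IsBipartiteWith A B)
    {u v : V} (hu : u ∈ B) (h : G.edges.Adj u v ∨ G.arc u v ∨ G.arc v u) : v ∈ A := by
  have hd : u ∉ A := fun h => Set.disjoint_left.1 hAB.2.1 h hu
  have h' : (u ∈ A ∧ v ∈ B) ∨ (u ∈ B ∧ v ∈ A) := by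
    rcases h with h | h | h
    · exact hAB.2.2 u v (Or.inl h)
    · exact hAB.2.2 u v (Or.inr h)
    · rcases hAB.2.2 v u (Or.inr h) with h | h
      · exact Or.inr ⟨h.2, h.1⟩
      · exact Or.inl ⟨h.2, h.1⟩
  exact (h'.resolve_left fun h => hd h.1).2

theorem ncard_inter_add_le [Finite V] {A M S : Set V} (h : M ⊆ A) :
    (A ∩ S).ncard + M.ncard ≤ A.ncard + (S ∩ M).ncard := by
  have h1 : A ∩ S ⊆ (A \ M) ∪ (S ∩ M) := by
    rintro a ⟨ha, hs⟩
    by_cases hm : a ∈ M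
    · exact Or.inr ⟨hs, hm⟩
    · exact Or.inl ⟨ha, hm⟩
  have h2 := (Set.ncard_le_ncard h1 (Set.toFinite _)).trans (Set.ncard_union_le _ _)
  have h3 := Set.ncard_sdiff_add_ncard_of_subset h (Set.toFinite _)
  omega

/-- At most 5 vertices of `N*(u)` lie in `S`, and a path between two vertices of `B` has two edges
per vertex of `A`. -/
theorem IsBridgeless.orientedDiam_le_ten [Finite V] {G : MixedGraph V} {A B : Set V}
    (hAB : G.IsBipartiteWith A B) (hG : G.IsBridgeless) {u : V} (hu : u ∈ B) :
    G.orientedDiam ≤ ((2 * (A.ncard - G.undirDegree u) + 10 : ℕ) : ℕ∞) := by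
  obtain ⟨D, hD⟩ := exists_isStrongOrientation hG
  obtain ⟨J, hJ⟩ := (hD.isRooted u).exists_relabel_spread
  obtain ⟨D', hD', hstep⟩ := hD.exists_relabel (J := J) fun x y => by
    obtain ⟨S, -, h, -⟩ := hJ x y
    exact h.reflTransGen
  refine orientedDiam_le hD' fun x y => ?_
  obtain ⟨S, hxS, hS, hc, -⟩ := hJ x y
  refine (hD'.1.isBipartiteWith hAB).dist_le (hS.mono (fun a b _ _ h => hstep a b h) subset_rfl)
    hxS ?_
  have hNA : G.undirNeighbors u ⊆ A := fun v hv => hAB.mem_left hu (Or.inl hv)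
  have h1 := ncard_inter_add_le (S := S) hNA
  unfold undirDegree
  omega

theorem IsBridgeless.orientedDiam_le_eight [Finite V] {G : MixedGraph V} {A B : Set V}
    (hAB : G.IsBipartiteWith A B) (hG : G.IsBridgeless) {u : V} (hu : u ∈ B)
    (h2 : 2 ≤ G.outDegree u + G.inDegree u) :
    G.orientedDiam ≤ ((2 * (A.ncard - G.undirDegree u) + 8 : ℕ) : ℕ∞) := by
  obtain ⟨D, hD⟩ := exists_isStrongOrientation hG
  have hout : ∀ z, D.arcsOff (G.undirNeighbors u) u u z ↔ G.arc u z := by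
    intro z
    constructor
    · intro h
      exact (hD.1.2.2.2 u z h.1).resolve_left fun h' => h.2.1 ⟨rfl, h'⟩
    · intro h
      refine ⟨hD.1.2.1 u z h, fun h' => G.edges_disjoint_arc _ _ h'.2 h, ?_⟩
      rintro ⟨h', -⟩
      exact G.edges.loopless.irrefl u h'
  have hin : ∀ z, D.arcsOff (G.undirNeighbors u) u z u ↔ G.arc z u := by
    intro z
    constructor
    · intro h
      exact (hD.1.2.2.2 z u h.1).resolve_left fun h' => h.2.2 ⟨h'.symm, rfl⟩
    · intro h
      refine ⟨hD.1.2.1 z u h, ?_, fun h' => G.edges_disjoint_arc _ _ h'.1.symm h⟩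
      rintro ⟨-, h'⟩
      exact G.edges.loopless.irrefl u h'
  obtain ⟨J, hJ⟩ := (hD.isRooted u).exists_relabel_of_two_le
    (fun a b h h' => D.arc_asymm _ _ h.1 h'.1) (fun z h h' => D.arc_asymm _ _ h.1 h')
    (fun z h => h.1) (by simp only [hout, hin]; exact h2)
  obtain ⟨D', hD', hstep⟩ := hD.exists_relabel (J := J) fun x y => by
    obtain ⟨S, -, h, -⟩ := hJ x y
    exact h.reflTransGen
  refine orientedDiam_le hD' fun x y => ?_
  obtain ⟨S, hxS, hS, hc⟩ := hJ x y
  refine (hD'.1.isBipartiteWith hAB).dist_le (hS.mono (fun a b _ _ h => hstep a b h) subset_rfl)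
    hxS ?_
  set Z := arcNeighbors (D.arcsOff (G.undirNeighbors u) u) u with hZ
  have hNA : G.undirNeighbors u ∪ Z ⊆ A := by
    rintro v (hv | hv | hv)
    · exact hAB.mem_left hu (Or.inl hv)
    · exact hAB.mem_left hu (Or.inr (Or.inl ((hout v).1 hv)))
    · exact hAB.mem_left hu (Or.inr (Or.inr ((hin v).1 hv)))
  have hdisj : Disjoint (G.undirNeighbors u) Z := by
    rw [Set.disjoint_left]
    rintro v hv (h | h)
    · exact G.edges_disjoint_arc _ _ hv ((hout v).1 h)
    · exact G.edges_disjoint_arc _ _ (SimpleGraph.Adj.symm hv) ((hin v).1 h)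
  -- `Z.ncard` occurs in the number of neighbors and in the bound on those in `S`; it cancels and
  -- leaves the 4.
  have h1 := ncard_inter_add_le (S := S) hNA
  rw [Set.ncard_union_eq hdisj (Set.toFinite _) (Set.toFinite _)] at h1
  unfold undirDegree
  omega

/-! ### Undirected graphs: components outside the closed neighborhood of the root. -/

section

variable (H : SimpleGraph V) (u : V)

/-- The closed neighborhood of `u`. -/
def closedNeighbors : Set V := insert u (H.neighborSet u)

/-- `p` and `q` lie in the same component after the closed neighborhood of `u` is deleted. -/
def SameComp : V → V → Prop := ReachIn H.Adj (closedNeighbors H u)ᶜ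

/-- The neighbor `v` of `u` is adjacent to the component of `p`. -/
def Touches (p v : V) : Prop := v ∈ H.neighborSet u ∧ ∃ q, SameComp H u p q ∧ H.Adj q v

/-- Two neighbors of `u` are adjacent to a common component. -/
def Linked (v w : V) : Prop :=
  v ≠ w ∧ ∃ p, p ∉ closedNeighbors H u ∧ Touches H u p v ∧ Touches H u p w

/-- The component of `p` is adjacent to a vertex of `I` and to a neighbor of `u` outside `I`. -/
def MeetsBoth (I : Set V) (p : V) : Prop :=
  p ∉ closedNeighbors H u ∧ (∃ v, Touches H u p v ∧ v ∉ I) ∧ ∃ w, Touches H u p w ∧ w ∈ I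

/-- The component of `p` is adjacent to `v` and to no other neighbor of `u`. -/
def IsPendant (p v : V) : Prop :=
  p ∉ closedNeighbors H u ∧ Touches H u p v ∧ ∀ w, Touches H u p w → w = v

/-- Edges are directed from `u` over the neighbors outside `I`, the components meeting both kinds
of neighbors and the neighbors in `I` back to `u`. -/
def SplitRel (I : Set V) (a b : V) : Prop :=
  (a = u ∧ b ∈ H.neighborSet u ∧ b ∉ I) ∨ (a ∈ H.neighborSet u ∧ a ∈ I ∧ b = u) ∨
    (a ∈ H.neighborSet u ∧ a ∉ I ∧ MeetsBoth H u I b) ∨ (MeetsBoth H u I a ∧ b ∈ H.neighborSet u ∧ b ∈ I)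

/-- Every neighbor of `u` is linked to one with the other label. -/
def IsLabelling (I : Set V) : Prop :=
  ∀ v ∈ H.neighborSet u, ∃ w, Linked H u v w ∧ (w ∈ I ↔ v ∉ I)

/-- `r` is a strong orientation of `H` that respects `SplitRel`. -/
structure IsSplit (I : Set V) (r : V → V → Prop) : Prop where
  adj : ∀ a b, r a b → H.Adj a b
  asymm : ∀ a b, r a b → ¬ r b a
  along : ∀ a b, H.Adj a b → SplitRel H u I a b → r a b
  strong : ∀ a b, ReflTransGen r a b

end

section

variable {H : SimpleGraph V} {u : V} {I : Set V} {r : V → V → Prop}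

theorem neighbor_mem {v : V} (h : v ∈ H.neighborSet u) : v ∈ closedNeighbors H u := Or.inr h

theorem root_not_mem_neighborSet : u ∉ H.neighborSet u := fun h => H.loopless.irrefl u h

theorem root_mem : u ∈ closedNeighbors H u := Or.inl rfl

theorem SameComp.not_mem {p q : V} (h : SameComp H u p q) (hp : p ∉ closedNeighbors H u) :
    q ∉ closedNeighbors H u := by
  rcases ReflTransGen.cases_tail h with rfl | ⟨c, -, hc⟩
  · exact hp
  · exact hc.2.2

theorem SameComp.symm {p q : V} (h : SameComp H u p q) : SameComp H u q p :=
  h.swap.mono (fun _ _ _ _ h => h.symm) subset_rfl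

theorem SameComp.touches_iff {p q v : V} (h : SameComp H u p q) :
    Touches H u q v ↔ Touches H u p v :=
  and_congr_right fun _ => ⟨fun ⟨a, h1, h2⟩ => ⟨a, h.trans h1, h2⟩,
    fun ⟨a, h1, h2⟩ => ⟨a, h.symm.trans h1, h2⟩⟩

theorem SameComp.meetsBoth {p q : V} (h : SameComp H u p q) (hp : MeetsBoth H u I p) : MeetsBoth H u I q := by
  obtain ⟨h1, ⟨v, h2, h3⟩, w, h4, h5⟩ := hp
  exact ⟨h.not_mem h1, ⟨v, h.touches_iff.2 h2, h3⟩, w, h.touches_iff.2 h4, h5⟩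

theorem SameComp.tail {p q s : V} (h : SameComp H u p q) (hp : p ∉ closedNeighbors H u)
    (hqs : H.Adj q s) (hs : s ∉ closedNeighbors H u) : SameComp H u p s :=
  ReachIn.trans h (ReachIn.single hqs (h.not_mem hp) hs)

theorem Linked.symm {v w : V} (h : Linked H u v w) : Linked H u w v :=
  ⟨h.1.symm, h.2.imp fun _ h => ⟨h.1, h.2.2, h.2.1⟩⟩

theorem meetsBoth_compl {p : V} : MeetsBoth H u Iᶜ p ↔ MeetsBoth H u I p := by
  unfold MeetsBoth
  simp only [Set.mem_compl_iff, not_not]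
  tauto

theorem splitRel_compl {a b : V} : SplitRel H u Iᶜ b a ↔ SplitRel H u I a b := by
  unfold SplitRel
  simp only [meetsBoth_compl, Set.mem_compl_iff, not_not]
  tauto

theorem IsLabelling.compl (h : IsLabelling H u I) : IsLabelling H u Iᶜ := by
  intro v hv
  obtain ⟨w, h1, h2⟩ := h v hv
  exact ⟨w, h1, by simp only [Set.mem_compl_iff]; tauto⟩

theorem IsSplit.flip (h : IsSplit H u I r) : IsSplit H u Iᶜ (fun a b => r b a) where
  adj a b hab := (h.adj b a hab).symm
  asymm a b hab := h.asymm b a hab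
  along a b hab hs := h.along b a hab.symm (splitRel_compl.1 hs)
  strong a b := reflTransGen_flip (h.strong b a)

theorem splitRel_asymm {a b : V} (h : SplitRel H u I a b) : ¬ SplitRel H u I b a := by
  have huN : u ∉ H.neighborSet u := root_not_mem_neighborSet
  have hM : ∀ p, MeetsBoth H u I p → p ∉ H.neighborSet u ∧ p ≠ u := fun p hp =>
    ⟨fun h => hp.1 (neighbor_mem h), fun h => hp.1 (h ▸ root_mem)⟩
  have ha := hM a
  have hb := hM b
  rintro (⟨h1, h2, h3⟩ | ⟨h1, h2, h3⟩ | ⟨h1, h2, h3⟩ | ⟨h1, h2, h3⟩) <;>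
  rcases h with (⟨k1, k2, k3⟩ | ⟨k1, k2, k3⟩ | ⟨k1, k2, k3⟩ | ⟨k1, k2, k3⟩) <;>
  first
  | exact h3 k2
  | exact k3 h2
  | exact k2 h3
  | exact h2 k3
  | exact (ha h3).2 k1
  | exact (hb h1).2 k3
  | exact (ha h3).1 k1
  | exact (hb h1).1 k2
  | exact (hb k3).2 h1
  | exact (ha k1).2 h3
  | exact (hb k3).1 h1
  | exact (ha k1).1 h2
  | (subst h1; exact huN k2)
  | (subst h3; exact huN k1)

theorem splitRel_congr_not {a b : V} (ha : a ∉ H.neighborSet u) (hau : a ≠ u)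
    (hb : b ∉ H.neighborSet u) : ¬ SplitRel H u I a b := by
  rintro (⟨h, -⟩ | ⟨h, -⟩ | ⟨h, -⟩ | ⟨-, h, -⟩)
  · exact hau h
  · exact ha h
  · exact ha h
  · exact hb h

theorem exists_touches (hc : ∀ a b, ReflTransGen H.Adj a b) {p : V}
    (hp : p ∉ closedNeighbors H u) : ∃ v, Touches H u p v := by
  by_contra! hcon
  have key : ∀ b, ReflTransGen H.Adj p b → SameComp H u p b := by
    intro b hb
    induction hb with
    | refl => exact ReflTransGen.refl
    | @tail a b _ hab ih =>
      refine ih.tail hp hab ?_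
      rintro (rfl | hb)
      · exact ih.not_mem hp (neighbor_mem hab.symm)
      · exact hcon b ⟨hb, a, ih, hab⟩
  exact (key u (hc p u)).not_mem hp root_mem

/-- Otherwise a walk from `v` that avoids the edge `uv` stays in `v` and the components touching
`v`, which touch no other neighbor of `u`. Then `uv` is a bridge. -/
theorem exists_linked (hNN : ∀ a ∈ H.neighborSet u, ∀ b ∈ H.neighborSet u, ¬ H.Adj a b)
    (hb : ∀ a b, H.Adj a b → (H.deleteEdges {s(a, b)}).Connected) {v : V}
    (hv : v ∈ H.neighborSet u) : ∃ w, Linked H u v w := by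
  by_contra! hcon
  have key : ∀ b, ReflTransGen (H.deleteEdges {s(u, v)}).Adj v b →
      b = v ∨ b ∉ closedNeighbors H u ∧ Touches H u b v := by
    intro b hb
    induction hb with
    | refl => exact Or.inl rfl
    | @tail a b _ hab ih =>
      rw [SimpleGraph.deleteEdges_adj, Set.mem_singleton_iff] at hab
      obtain ⟨hab, hne⟩ := hab
      rcases ih with rfl | ⟨ha, hav⟩
      · right
        have hb : b ∉ closedNeighbors H u := by
          rintro (rfl | hb)
          · exact hne Sym2.eq_swap
          · exact hNN _ hv _ hb hab
        exact ⟨hb, hv, b, ReflTransGen.refl, hab.symm⟩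
      · by_cases hbW : b ∈ closedNeighbors H u
        · rcases hbW with rfl | hb
          · exact absurd (neighbor_mem hab.symm) ha
          · by_contra! hbv
            exact hcon b ⟨fun h => hbv.1 h.symm, a, ha, hav, hb, a, ReflTransGen.refl, hab⟩
        · have : SameComp H u a b := SameComp.tail (u := u) ReflTransGen.refl ha hab hbW
          exact Or.inr ⟨hbW, this.touches_iff.2 hav⟩
  have hr := (hb u v hv).preconnected v u
  rw [SimpleGraph.reachable_iff_reflTransGen] at hr
  rcases key u hr with rfl | h
  · exact H.loopless.irrefl _ hv
  · exact h.1 root_mem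

/-- Fixing the directions of `SplitRel` does not cut `x` off from `u`: a neighbor in `I` points to
`u`, a component meeting both labels leads into `I`, a neighbor outside `I` points into such a
component, and the other components keep their edges undirected. Complementing `I` gives the paths
from `u`. -/
theorem IsLabelling.reach (hI : IsLabelling H u I) (hc : ∀ a b, ReflTransGen H.Adj a b) (x : V) :
    ReflTransGen (fun a b => H.Adj a b ∧ ¬ SplitRel H u I b a) x u := by
  have hin : ∀ v ∈ H.neighborSet u, v ∈ I →
      ReflTransGen (fun a b => H.Adj a b ∧ ¬ SplitRel H u I b a) v u := by
    intro v hv hvI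
    exact ReflTransGen.single ⟨SimpleGraph.Adj.symm hv,
      splitRel_asymm (Or.inr (Or.inl ⟨hv, hvI, rfl⟩))⟩
  have hcomp : ∀ p q, p ∉ closedNeighbors H u → SameComp H u p q →
      ReflTransGen (fun a b => H.Adj a b ∧ ¬ SplitRel H u I b a) p q := by
    intro p q _ hpq
    refine reflTransGen_of_imp ?_ hpq
    rintro a b ⟨hab, ha, hb⟩
    exact ⟨hab, splitRel_congr_not (fun h => hb (neighbor_mem h)) (fun h => hb (h ▸ root_mem))
      (fun h => ha (neighbor_mem h))⟩
  have hmix : ∀ p, MeetsBoth H u I p →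
      ReflTransGen (fun a b => H.Adj a b ∧ ¬ SplitRel H u I b a) p u := by
    rintro p hp
    obtain ⟨hpW, -, w, ⟨hwN, q, hpq, hqw⟩, hwI⟩ := id hp
    exact (hcomp p q hpW hpq).trans ((hin w hwN hwI).head
      ⟨hqw, splitRel_asymm (Or.inr (Or.inr (Or.inr ⟨hpq.meetsBoth hp, hwN, hwI⟩)))⟩)
  have hout : ∀ v ∈ H.neighborSet u,
      ReflTransGen (fun a b => H.Adj a b ∧ ¬ SplitRel H u I b a) v u := by
    intro v hv
    by_cases hvI : v ∈ I
    · exact hin v hv hvI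
    obtain ⟨w, ⟨hvw, p, hp, hpv, hpw⟩, hw⟩ := hI v hv
    have hpm : MeetsBoth H u I p := ⟨hp, ⟨v, hpv, hvI⟩, w, hpw, hw.2 hvI⟩
    obtain ⟨-, q, hpq, hqv⟩ := hpv
    exact (hmix q (hpq.meetsBoth hpm)).head ⟨hqv.symm,
      splitRel_asymm (Or.inr (Or.inr (Or.inl ⟨hv, hvI, hpq.meetsBoth hpm⟩)))⟩
  by_cases hx : x ∈ closedNeighbors H u
  · rcases hx with rfl | hx
    · exact ReflTransGen.refl
    · exact hout x hx
  by_cases hxm : MeetsBoth H u I x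
  · exact hmix x hxm
  obtain ⟨v, hv, q, hxq, hqv⟩ := exists_touches hc hx
  refine (hcomp x q hx hxq).trans ((hout v hv).head ⟨hqv, ?_⟩)
  rintro (⟨rfl, -⟩ | ⟨-, -, rfl⟩ | ⟨-, -, h⟩ | ⟨h, -⟩)
  · exact root_not_mem_neighborSet hv
  · exact hxq.not_mem hx root_mem
  · exact hxm (hxq.symm.meetsBoth h)
  · exact h.1 (neighbor_mem hv)

theorem exists_isSplit [Finite V] {G : MixedGraph V} (hG : G.IsBridgeless)
    (hund : G.IsUndirected) {I : Set V} (hI : IsLabelling G.edges u I) :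
    ∃ D : MixedGraph V, D.IsStrongOrientation G ∧ IsSplit G.edges u I D.arc := by
  have hc : ∀ a b, ReflTransGen G.edges.Adj a b := fun a b =>
    reflTransGen_of_imp (fun a b h => h.resolve_right (hund a b)) (isConnected_iff.1 hG.1 a b)
  have hF : ∀ a b, SplitRel G.edges u I a b → ¬ SplitRel G.edges u I b a :=
    fun a b h => splitRel_asymm h
  have hb : (G.orientBy _ hF).IsBridgeless := by
    refine orientBy_bridgeless hG (isConnected_iff.2 fun x y => ?_)
    refine ReflTransGen.trans (b := u) ?_ ?_
    · exact reflTransGen_of_imp (fun a b h => orientBy_step.2 (Or.inr h)) (hI.reach hc x)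
    · refine reflTransGen_of_imp (fun a b h => orientBy_step.2 (Or.inr ⟨h.1.symm, ?_⟩))
        (reflTransGen_flip (hI.compl.reach hc y))
      exact fun h' => h.2 (splitRel_compl.2 h')
  obtain ⟨D, hD⟩ := exists_isStrongOrientation hb
  have hD' := hD.of_orientBy
  refine ⟨D, hD', ⟨fun a b h => (hD'.1.2.2.2 a b h).resolve_right (hund a b), D.arc_asymm, ?_, ?_⟩⟩
  · exact fun a b h h' => hD.1.2.1 a b (Or.inr ⟨h, h'⟩)
  · exact fun a b => reflTransGen_of_imp (fun a b h => h.resolve_left (hD'.1.1 a b))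
      (isConnected_iff.1 hD'.2 a b)

/-- The vertices that a path starting in `x` and meeting the neighbors of `u` only in `s` uses. -/
def splitRegion (H : SimpleGraph V) (u : V) (I : Set V) (x : V) (s : Set V) : Set V :=
  {a | a = u ∨ (x ∉ closedNeighbors H u ∧ SameComp H u x a) ∨ MeetsBoth H u I a ∨ a ∈ s}

theorem IsSplit.isRooted (h : IsSplit H u I r) :
    IsRooted (fun a b => r a b ∧ a ≠ u ∧ b ≠ u) (H.neighborSet u) u I where
  root_not_mem := root_not_mem_neighborSet
  irrefl_root h := h.2.1 rfl
  root_left _ _ h := h.2.1 rfl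
  root_right _ _ h := h.2.2 rfl
  strong x y := by
    refine reflTransGen_of_imp ?_ (h.strong x y)
    intro a b hab
    by_cases hau : a = u
    · subst hau
      have hb : b ∈ H.neighborSet a := h.adj _ _ hab
      refine Or.inr (Or.inr ⟨rfl, hb, fun hbI => ?_⟩)
      exact h.asymm _ _ hab (h.along _ _ hb.symm (Or.inr (Or.inl ⟨hb, hbI, rfl⟩)))
    by_cases hbu : b = u
    · subst hbu
      have ha : a ∈ H.neighborSet b := (h.adj _ _ hab).symm
      refine Or.inr (Or.inl ⟨ha, by_contra fun haI => ?_, rfl⟩)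
      exact h.asymm _ _ hab (h.along _ _ ha (Or.inl ⟨rfl, ha, haI⟩))
    exact Or.inl ⟨hab, hau, hbu⟩

/-- Until it first enters `N(u)` the path stays in the component of `x`. From a component meeting
both labels it can only enter `I`, since the edges to the other label point inwards. -/
theorem IsSplit.freeReach (h : IsSplit H u I r) {x v : V} (hx : x ∉ closedNeighbors H u)
    (hv : v ∈ H.neighborSet u)
    (hxv : FreeReach (fun a b => r a b ∧ a ≠ u ∧ b ≠ u) (insert u (H.neighborSet u)) x v) :
    Touches H u x v ∧ (MeetsBoth H u I x → v ∈ I) ∧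
      ∀ s, v ∈ s → ReachIn r (splitRegion H u I x s) x v := by
  have key : ∀ b, FreeReach (fun a b => r a b ∧ a ≠ u ∧ b ≠ u) (insert u (H.neighborSet u)) x b →
      b ∉ closedNeighbors H u → SameComp H u x b := by
    intro b hb
    induction hb with
    | refl => exact fun _ => ReflTransGen.refl
    | @tail c d _ hcd ih => exact fun hd => (ih hcd.2).tail hx (h.adj _ _ hcd.1.1) hd
  rcases ReflTransGen.cases_tail hxv with rfl | ⟨q, hxq, hqv⟩
  · exact absurd (neighbor_mem hv) hx
  have hxq' := key q hxq hqv.2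
  refine ⟨⟨hv, q, hxq', h.adj _ _ hqv.1.1⟩, fun hm => by_contra fun hvI => ?_, fun s hs => ?_⟩
  · exact h.asymm _ _ hqv.1.1 (h.along _ _ (h.adj _ _ hqv.1.1).symm
      (Or.inr (Or.inr (Or.inl ⟨hv, hvI, hxq'.meetsBoth hm⟩))))
  · refine (reachIn_between hxv).mono (fun a b _ _ h => h.1.1) ?_
    rintro a ⟨h1, h2⟩
    rcases FreeReach.not_mem h2 with h3 | rfl
    · exact Or.inr (Or.inl ⟨hx, key a h1 h3⟩)
    · exact Or.inr (Or.inr (Or.inr hs))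

/-- A first neighbor `v ∈ I` points to `u`. Otherwise `v` points into a component meeting both
labels; that component is left at some `t ∈ I`, linked to `v` through it, and `t` points to `u`. -/
theorem IsSplit.exists_region (h : IsSplit H u I r) (hI : IsLabelling H u I) {x : V}
    (hx : x ≠ u) : ∃ v ∈ H.neighborSet u,
      (x = v ∨ x ∉ closedNeighbors H u ∧ Touches H u x v ∧ (MeetsBoth H u I x → v ∈ I)) ∧
      ∃ s ⊆ H.neighborSet u, v ∈ s ∧ ReachIn r (splitRegion H u I x s) x u ∧
        (v ∈ I → s = {v}) ∧ (v ∉ I → ∃ t, Linked H u v t ∧ s = {v, t}) := by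
  have hto : ∀ x, x ≠ u → ∃ v ∈ H.neighborSet u,
      FreeReach (fun a b => r a b ∧ a ≠ u ∧ b ≠ u) (insert u (H.neighborSet u)) x v :=
    fun x hx => (h.isRooted.exists_to hx).resolve_right fun ⟨z, hz, _⟩ => hz.2.2 rfl
  obtain ⟨v, hv, hxv, hreach⟩ : ∃ v ∈ H.neighborSet u,
      (x = v ∨ x ∉ closedNeighbors H u ∧ Touches H u x v ∧ (MeetsBoth H u I x → v ∈ I)) ∧
      ∀ s, v ∈ s → ReachIn r (splitRegion H u I x s) x v := by
    by_cases hxW : x ∈ closedNeighbors H u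
    · exact ⟨x, hxW.resolve_left hx, Or.inl rfl, fun s _ => ReflTransGen.refl⟩
    · obtain ⟨v, hv, hxv⟩ := hto x hx
      obtain ⟨h1, h2, h3⟩ := h.freeReach hxW hv hxv
      exact ⟨v, hv, Or.inr ⟨hxW, h1, h2⟩, h3⟩
  refine ⟨v, hv, hxv, ?_⟩
  by_cases hvI : v ∈ I
  · refine ⟨{v}, Set.singleton_subset_iff.2 hv, rfl, (hreach {v} rfl).trans (ReachIn.single ?_ ?_ ?_),
      fun _ => rfl, fun h => absurd hvI h⟩
    · exact h.along _ _ (SimpleGraph.Adj.symm hv) (Or.inr (Or.inl ⟨hv, hvI, rfl⟩))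
    · exact Or.inr (Or.inr (Or.inr rfl))
    · exact Or.inl rfl
  · obtain ⟨w, ⟨-, p, hp, hpv, hpw⟩, hw⟩ := hI v hv
    have hpm : MeetsBoth H u I p := ⟨hp, ⟨v, hpv, hvI⟩, w, hpw, hw.2 hvI⟩
    obtain ⟨-, q, hpq, hqv⟩ := id hpv
    have hqm := hpq.meetsBoth hpm
    obtain ⟨t, ht, hqt⟩ := hto q fun h => hqm.1 (h ▸ root_mem)
    obtain ⟨hqt1, hqt2, hqt3⟩ := h.freeReach hqm.1 ht hqt
    have htI := hqt2 hqm
    refine ⟨{v, t}, ?_, Or.inl rfl, (hreach {v, t} (Or.inl rfl)).trans ((ReachIn.single (y := q)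
      ?_ ?_ ?_).trans (((hqt3 {v, t} (Or.inr rfl)).mono_set ?_).trans (ReachIn.single ?_ ?_ ?_))),
      fun h => absurd h hvI, fun _ => ⟨t, ⟨?_, p, hp, hpv, hpq.touches_iff.1 hqt1⟩, rfl⟩⟩
    · rintro a (rfl | rfl)
      · exact hv
      · exact ht
    · exact h.along _ _ hqv.symm (Or.inr (Or.inr (Or.inl ⟨hv, hvI, hqm⟩)))
    · exact Or.inr (Or.inr (Or.inr (Or.inl rfl)))
    · exact Or.inr (Or.inr (Or.inl hqm))
    · rintro a (rfl | ⟨-, ha⟩ | ha | ha)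
      · exact Or.inl rfl
      · exact Or.inr (Or.inr (Or.inl (ha.meetsBoth hqm)))
      · exact Or.inr (Or.inr (Or.inl ha))
      · exact Or.inr (Or.inr (Or.inr ha))
    · exact h.along _ _ (SimpleGraph.Adj.symm ht) (Or.inr (Or.inl ⟨ht, htI, rfl⟩))
    · exact Or.inr (Or.inr (Or.inr (Or.inr rfl)))
    · exact Or.inl rfl
    · rintro rfl; exact hvI htI

/-! ### Labellings with prescribed values. -/

/-- A labelling whose complement is independent and contains a given independent set. -/
theorem exists_labelling_independent [Finite V]
    (hL : ∀ v ∈ H.neighborSet u, ∃ w, Linked H u v w) {O : Set V}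
    (hO : ∀ v ∈ O, ∀ w ∈ O, ¬ Linked H u v w) :
    ∃ I, IsLabelling H u I ∧ (∀ w ∈ O, w ∉ I) ∧ ∀ v w, v ∉ I → w ∉ I → ¬ Linked H u v w := by
  obtain ⟨I, ⟨h1, h2⟩, hmin⟩ := exists_minimal_set (P := fun I : Set V =>
    (∀ w ∈ O, w ∉ I) ∧ ∀ v w, v ∉ I → w ∉ I → ¬ Linked H u v w) (J₀ := Oᶜ)
    ⟨fun w hw h => h hw, fun v w hv hw => hO v (not_not.1 hv) w (not_not.1 hw)⟩
  refine ⟨I, fun v hv => ?_, h1, h2⟩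
  by_cases hvI : v ∈ I
  -- The complement of `I` is a maximal independent set: if `v` had no partner outside `I`, it could
  -- be moved there.
  · by_contra! hcon
    have hcon' : ∀ w, w ∉ I → ¬ Linked H u v w := fun w hw hl => by
      rcases hcon w hl with h | h
      · exact hw h.1
      · exact h.2 hvI
    refine hmin v hvI ⟨fun w hw h => h1 w hw h.1, fun a b ha hb hab => ?_⟩
    have ha' : a = v ∨ a ∉ I := by
      by_contra! h; exact ha ⟨h.2, h.1⟩
    have hb' : b = v ∨ b ∉ I := by
      by_contra! h; exact hb ⟨h.2, h.1⟩
    rcases ha' with rfl | ha' <;> rcases hb' with rfl | hb'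
    · exact hab.1 rfl
    · exact hcon' b hb' hab
    · exact hcon' a ha' hab.symm
    · exact h2 a b ha' hb' hab
  · obtain ⟨w, hw⟩ := hL v hv
    refine ⟨w, hw, fun _ => hvI, fun _ => by_contra fun hwI => h2 v w hvI hwI hw⟩

/-- A labelling with prescribed labels on two sets that are linked to each other. -/
theorem exists_labelling_extending [Finite V]
    (hL : ∀ v ∈ H.neighborSet u, ∃ w, Linked H u v w) {S T : Set V} (hST : ∀ v ∈ S, v ∉ T)
    (hS : ∀ v ∈ S, ∃ w ∈ T, Linked H u v w) (hT : ∀ v ∈ T, ∃ w ∈ S, Linked H u v w) :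
    ∃ I, IsLabelling H u I ∧ S ⊆ I ∧ ∀ v ∈ T, v ∉ I := by
  obtain ⟨I, ⟨h1, h2, h3⟩, hmin⟩ := exists_minimal_set (P := fun I : Set V =>
    S ⊆ I ∧ (∀ v ∈ T, v ∉ I) ∧ ∀ v ∈ H.neighborSet u, v ∉ I → ∃ w ∈ I, Linked H u v w)
    (J₀ := Tᶜ) ⟨hST, fun w hw h => h hw, fun v _ hv => by
      obtain ⟨w, hw, h⟩ := hT v (not_not.1 hv)
      exact ⟨w, hST w hw, h⟩⟩
  refine ⟨I, fun v hv => ?_, h1, h2⟩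
  by_cases hvI : v ∈ I
  -- `I` is a minimal dominating set for the relation `Linked`. If `v` had no partner outside `I`,
  -- it could be removed, being itself dominated by a partner inside.
  · by_contra! hcon
    have hcon' : ∀ w, w ∉ I → ¬ Linked H u v w := fun w hw hl => by
      rcases hcon w hl with h | h
      · exact hw h.1
      · exact h.2 hvI
    have hvS : v ∉ S := fun hvS => by
      obtain ⟨w, hw, h⟩ := hS v hvS
      exact hcon' w (h2 w hw) h
    refine hmin v hvI ⟨fun a ha => ⟨h1 ha, by rintro rfl; exact hvS ha⟩,
      fun w hw h => h2 w hw h.1, fun a ha haI => ?_⟩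
    by_cases hav : a = v
    · subst hav
      obtain ⟨w, hw⟩ := hL a ha
      exact ⟨w, ⟨by_contra fun h => hcon' w h hw, fun h => hw.1 h.symm⟩, hw⟩
    · have haI' : a ∉ I := fun h => haI ⟨h, hav⟩
      obtain ⟨w, hw, h⟩ := h3 a ha haI'
      refine ⟨w, ⟨hw, ?_⟩, h⟩
      rintro rfl
      exact hcon' a haI' h.symm
  · obtain ⟨w, hw, h⟩ := h3 v hv hvI
    exact ⟨w, h, fun _ => hvI, fun _ => hw⟩

end

/-! ### Economical labellings and pendant components. -/

section

variable {H : SimpleGraph V} {u : V} {I : Set V} {r : V → V → Prop}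

/-- `s` has at most one element, or `x` lies in a component all of whose neighbors have the wrong
label. -/
def NearRoot (H : SimpleGraph V) (u : V) (I : Set V) (x : V) (s : Set V) : Prop :=
  s.ncard ≤ 1 ∨ ∃ v t, x ∉ closedNeighbors H u ∧ v ∉ I ∧ Touches H u x v ∧
    ¬ MeetsBoth H u I x ∧ Linked H u v t ∧ s = {v, t}

theorem splitRegion_compl {x : V} {s : Set V} :
    splitRegion H u Iᶜ x s = splitRegion H u I x s := by
  unfold splitRegion
  simp only [meetsBoth_compl]

theorem IsSplit.exists_region_nearRoot (h : IsSplit H u I r) (hI : IsLabelling H u I) (x : V) :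
    ∃ s ⊆ H.neighborSet u, x ∈ splitRegion H u I x s ∧ u ∈ splitRegion H u I x s ∧
      ReachIn r (splitRegion H u I x s) x u ∧
      s.ncard ≤ 2 ∧ (x ∉ H.neighborSet u → NearRoot H u I x s) := by
  by_cases hx : x = u
  · subst hx
    exact ⟨∅, Set.empty_subset _, Or.inl rfl, Or.inl rfl, ReflTransGen.refl, by simp,
      fun _ => Or.inl (by simp)⟩
  obtain ⟨v, hv, hxv, s, hsN, hvs, hs, h1, h2⟩ := h.exists_region hI hx
  refine ⟨s, hsN, ?_, Or.inl rfl, hs, ?_, ?_⟩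
  · rcases hxv with rfl | ⟨hxW, -⟩
    · exact Or.inr (Or.inr (Or.inr hvs))
    · exact Or.inr (Or.inl ⟨hxW, ReflTransGen.refl⟩)
  · by_cases hvI : v ∈ I
    · rw [h1 hvI, Set.ncard_singleton]; norm_num
    · obtain ⟨t, -, rfl⟩ := h2 hvI
      exact ncard_le_two_of_subset subset_rfl
  · intro hxN
    by_cases hvI : v ∈ I
    · exact Or.inl (by rw [h1 hvI, Set.ncard_singleton])
    · obtain ⟨t, ht, rfl⟩ := h2 hvI
      rcases hxv with rfl | ⟨hxW, hxv, hm⟩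
      · exact absurd hv hxN
      · exact Or.inr ⟨v, t, hxW, hvI, hxv, fun h => hvI (hm h), ht, rfl⟩

theorem splitRegion_inter {x : V} {s : Set V} :
    splitRegion H u I x s ∩ H.neighborSet u ⊆ s := by
  rintro a ⟨rfl | ⟨hx, h⟩ | h | h, ha⟩
  · exact absurd ha root_not_mem_neighborSet
  · exact absurd (neighbor_mem ha) (h.not_mem hx)
  · exact absurd (neighbor_mem ha) h.1
  · exact h

/-- The edge from the component to `v` is no bridge, so its end `q` has a further neighbor, which
must lie in the component. This provides a vertex of `A` in every pendant component. -/
theorem IsPendant.exists_adj {p v : V} (hb : ∀ a b, H.Adj a b → (H.deleteEdges {s(a, b)}).Connected)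
    (h : IsPendant H u p v) :
    ∃ q a, H.Adj q v ∧ H.Adj q a ∧ a ∉ closedNeighbors H u ∧ SameComp H u p a := by
  obtain ⟨hp, ⟨-, q, hpq, hqv⟩, huniq⟩ := h
  have hq := hpq.not_mem hp
  have hr := (hb q v hqv).preconnected q v
  rw [SimpleGraph.reachable_iff_reflTransGen] at hr
  rcases ReflTransGen.cases_head hr with h | ⟨c, hqc, -⟩
  · exact absurd h (H.ne_of_adj hqv)
  rw [SimpleGraph.deleteEdges_adj, Set.mem_singleton_iff] at hqc
  have hc : c ∉ closedNeighbors H u := by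
    rintro (rfl | hc)
    · exact hq (neighbor_mem hqc.1.symm)
    · exact hqc.2 (by rw [huniq c ⟨hc, q, hpq, hqc.1⟩])
  exact ⟨q, c, hqv, hqc.1, hc, hpq.tail hp hqc.1 hc⟩

theorem IsPendant.eq_of_touches {p v x w : V} (h : IsPendant H u p v) (hx : SameComp H u p x)
    (hw : Touches H u x w) : w = v :=
  h.2.2 w (hx.touches_iff.1 hw)

/-- A pendant component touches a single label, so a region contains its vertices only when it
starts there. -/
theorem IsPendant.not_mem_splitRegion {p v a x : V} (h : IsPendant H u p v)
    (ha : SameComp H u p a) (hx : ¬ SameComp H u p x) {s : Set V} (hs : s ⊆ H.neighborSet u) :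
    a ∉ splitRegion H u I x s := by
  have haW := ha.not_mem h.1
  rintro (rfl | ⟨hxW, hxa⟩ | ⟨-, ⟨w, hw, hwI⟩, w', hw', hwI'⟩ | has)
  · exact haW root_mem
  · exact hx (ha.trans hxa.symm)
  · exact hwI (h.eq_of_touches ha hw ▸ h.eq_of_touches ha hw' ▸ hwI')
  · exact haW (neighbor_mem (hs has))

/-- Two vertices of `B` are joined through `u` by a path that meets at most three neighbors of `u`
or misses a vertex of `A` that is not a neighbor of `u`. -/
def IsEconomical (H : SimpleGraph V) (u : V) (A I : Set V) : Prop :=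
  ∀ x y s s', s ⊆ H.neighborSet u → s' ⊆ H.neighborSet u → s.ncard ≤ 2 → s'.ncard ≤ 2 →
    NearRoot H u I x s → NearRoot H u Iᶜ y s' → (s ∪ s').ncard ≤ 3 ∨
      ∃ a ∈ A, a ∉ H.neighborSet u ∧ a ∉ splitRegion H u I x s ∪ splitRegion H u I y s'

/-- A component touching `v ∉ I` and not meeting both labels touches only the complement of `I`; by
independence it touches `v` alone, so it is pendant and `v ∈ I`. Hence `s` has at most one element.
-/
theorem isEconomical_of_independent {A : Set V}
    (hind : ∀ v w, v ∉ I → w ∉ I → ¬ Linked H u v w)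
    (hpend : ∀ p v, IsPendant H u p v → v ∈ I) : IsEconomical H u A I := by
  intro x y s s' _ _ _ hs' hx _
  left
  have h1 : s.ncard ≤ 1 := by
    rcases hx with hx | ⟨v, t, hxW, hvI, hxv, hm, -, -⟩
    · exact hx
    exfalso
    refine hvI (hpend x v ⟨hxW, hxv, fun w hxw => ?_⟩)
    by_contra hne
    have hl : Linked H u v w := ⟨fun h => hne h.symm, x, hxW, hxv, hxw⟩
    exact hm ⟨hxW, ⟨v, hxv, hvI⟩, w, hxw, by_contra fun h => hind v w hvI h hl⟩
  have := Set.ncard_union_le s s'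
  omega

/-- If one of the two pendant components contains neither `x` nor `y`, its vertex of `A` is missed.
If `x` lies in the second, then `v₂ ∈ I` makes `s` small. If `x` lies in the first and `y` in the
second, either `s` or `s'` is small, or both contain `v₂`. -/
theorem isEconomical_of_pendant {A : Set V} {p₁ v₁ a₁ p₂ v₂ a₂ : V} (h₁ : IsPendant H u p₁ v₁)
    (h₂ : IsPendant H u p₂ v₂) (hne : v₁ ≠ v₂) (ha₁ : a₁ ∈ A) (hpa₁ : SameComp H u p₁ a₁)
    (ha₂ : a₂ ∈ A) (hpa₂ : SameComp H u p₂ a₂) (hv₂ : v₂ ∈ I)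
    (hv₁ : v₁ ∈ I ∨ ∀ t, Linked H u v₁ t → t = v₂) : IsEconomical H u A I := by
  intro x y s s' hs hs' hc hc' hx hy
  have hun := Set.ncard_union_le s s'
  have miss : ∀ {p v a}, IsPendant H u p v → a ∈ A → SameComp H u p a → ¬ SameComp H u p x →
      ¬ SameComp H u p y → ∃ a ∈ A, a ∉ H.neighborSet u ∧
        a ∉ splitRegion H u I x s ∪ splitRegion H u I y s' := by
    intro p v a h ha hpa hpx hpy
    refine ⟨a, ha, fun h' => hpa.not_mem h.1 (neighbor_mem h'), ?_⟩
    rintro (h' | h')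
    · exact h.not_mem_splitRegion hpa hpx hs h'
    · exact h.not_mem_splitRegion hpa hpy hs' h'
  have hdisj : ∀ z, SameComp H u p₁ z → ¬ SameComp H u p₂ z := by
    intro z h h'
    exact hne (h₂.eq_of_touches (h'.trans h.symm) h₁.2.1)
  have hx₂ : SameComp H u p₂ x → s.ncard ≤ 1 := by
    intro h
    rcases hx with hx | ⟨v, t, -, hvI, hxv, -⟩
    · exact hx
    · exact absurd (h₂.eq_of_touches h hxv ▸ hv₂) hvI
  by_cases hx1 : SameComp H u p₁ x
  · by_cases hy2 : SameComp H u p₂ y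
    · left
      rcases hx with hx | ⟨v, t, -, hvI, hxv, -, hvt, rfl⟩
      · omega
      rcases hy with hy | ⟨v', t', -, -, hyv, -, -, rfl⟩
      · omega
      obtain rfl := h₁.eq_of_touches hx1 hxv
      obtain rfl := h₂.eq_of_touches hy2 hyv
      obtain rfl := hv₁.resolve_left hvI t hvt
      apply ncard_le_three_of_subset (a := v) (b := t) (c := t')
      rintro a ((rfl | rfl) | (rfl | rfl))
      · exact Or.inl rfl
      · exact Or.inr (Or.inl rfl)
      · exact Or.inr (Or.inl rfl)
      · exact Or.inr (Or.inr rfl)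
    · exact Or.inr (miss h₂ ha₂ hpa₂ (hdisj x hx1) hy2)
  · by_cases hy1 : SameComp H u p₁ y
    · by_cases hx2 : SameComp H u p₂ x
      · left
        have := hx₂ hx2
        omega
      · exact Or.inr (miss h₂ ha₂ hpa₂ hx2 (hdisj y hy1))
    · exact Or.inr (miss h₁ ha₁ hpa₁ hx1 hy1)

theorem exists_isEconomical [Finite V] {A B : Set V}
    (hNN : ∀ a ∈ H.neighborSet u, ∀ b ∈ H.neighborSet u, ¬ H.Adj a b)
    (hb : ∀ a b, H.Adj a b → (H.deleteEdges {s(a, b)}).Connected)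
    (hNA : H.neighborSet u ⊆ A) (hAB : ∀ a b, H.Adj a b → a ∈ A → b ∈ B)
    (hBA : ∀ a b, H.Adj a b → a ∈ B → b ∈ A) :
    ∃ I, IsLabelling H u I ∧ IsEconomical H u A I := by
  have hL : ∀ v ∈ H.neighborSet u, ∃ w, Linked H u v w := fun v hv => exists_linked hNN hb hv
  by_cases hp : ∃ p₁ v₁, IsPendant H u p₁ v₁
  swap
  · obtain ⟨I, hI, -, hind⟩ := exists_labelling_independent hL (O := ∅) (fun v hv => hv.elim)
    exact ⟨I, hI, isEconomical_of_independent hind fun p v h => absurd ⟨p, v, h⟩ hp⟩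
  obtain ⟨p₁, v₁, h₁⟩ := hp
  by_cases hp' : ∃ p₂ v₂, IsPendant H u p₂ v₂ ∧ v₁ ≠ v₂
  swap
  · obtain ⟨w, hw⟩ := hL v₁ h₁.2.1.1
    -- All pendant components hang on `v₁`. Keeping its partner `w` out of `I` forces `v₁` into `I`
    -- by independence.
    obtain ⟨I, hI, hO, hind⟩ := exists_labelling_independent hL (O := {w}) (by
      rintro v rfl v' rfl h
      exact h.1 rfl)
    refine ⟨I, hI, isEconomical_of_independent hind fun p v h => ?_⟩
    have hv : v₁ = v := by
      by_contra hne
      exact hp' ⟨p, v, h, hne⟩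
    subst hv
    exact by_contra fun hvI => hind _ w hvI (hO w rfl) hw
  obtain ⟨p₂, v₂, h₂, hne⟩ := hp'
  have hmem : ∀ {p v}, IsPendant H u p v → ∃ a ∈ A, SameComp H u p a := by
    intro p v h
    obtain ⟨q, a, hqv, hqa, -, hpa⟩ := h.exists_adj hb
    exact ⟨a, hBA q a hqa (hAB v q hqv.symm (hNA h.2.1.1)), hpa⟩
  obtain ⟨a₁, ha₁, hpa₁⟩ := hmem h₁
  obtain ⟨a₂, ha₂, hpa₂⟩ := hmem h₂
  have pair : ∀ {v w}, v ≠ w → Linked H u v w →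
      ∃ I, IsLabelling H u I ∧ w ∈ I := by
    intro v w hvw hl
    obtain ⟨I, hI, hS, -⟩ := exists_labelling_extending hL (S := {w}) (T := {v})
      (by rintro _ rfl h; exact hvw h.symm) (by rintro _ rfl; exact ⟨v, rfl, hl.symm⟩)
      (by rintro _ rfl; exact ⟨w, rfl, hl⟩)
    exact ⟨I, hI, hS rfl⟩
  by_cases h12 : ∀ t, Linked H u v₁ t → t = v₂
  · obtain ⟨t, ht⟩ := hL v₁ h₁.2.1.1
    obtain rfl := h12 t ht
    obtain ⟨I, hI, htI⟩ := pair hne ht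
    exact ⟨I, hI, isEconomical_of_pendant h₁ h₂ hne ha₁ hpa₁ ha₂ hpa₂ htI (Or.inr h12)⟩
  by_cases h21 : ∀ t, Linked H u v₂ t → t = v₁
  · obtain ⟨t, ht⟩ := hL v₂ h₂.2.1.1
    obtain rfl := h21 t ht
    obtain ⟨I, hI, htI⟩ := pair hne.symm ht
    exact ⟨I, hI, isEconomical_of_pendant h₂ h₁ hne.symm ha₂ hpa₂ ha₁ hpa₁ htI (Or.inr h21)⟩
  push Not at h12 h21
  obtain ⟨w₁, hw₁, hw₁'⟩ := h12
  obtain ⟨w₂, hw₂, hw₂'⟩ := h21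
  -- Each of `v₁`, `v₂` has a partner other than the other one, so both can be placed in `I`.
  obtain ⟨I, hI, hS, -⟩ := exists_labelling_extending hL (S := {v₁, v₂}) (T := {w₁, w₂})
    (by
      rintro v (rfl | rfl) (h | h)
      · exact hw₁.1 h
      · exact hw₂' h.symm
      · exact hw₁' h.symm
      · exact hw₂.1 h)
    (by
      rintro v (rfl | rfl)
      · exact ⟨w₁, Or.inl rfl, hw₁⟩
      · exact ⟨w₂, Or.inr rfl, hw₂⟩)
    (by
      rintro v (rfl | rfl)
      · exact ⟨v₁, Or.inl rfl, hw₁.symm⟩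
      · exact ⟨v₂, Or.inr rfl, hw₂.symm⟩)
  exact ⟨I, hI, isEconomical_of_pendant h₁ h₂ hne ha₁ hpa₁ ha₂ hpa₂ (hS (Or.inr rfl))
    (Or.inl (hS (Or.inl rfl)))⟩

end

/-! ### The bound for undirected graphs. -/

theorem IsUndirected.degree_eq {G : MixedGraph V} (hund : G.IsUndirected) (u : V) :
    G.degree u = (G.edges.neighborSet u).ncard := by
  unfold degree
  congr 1
  ext v
  constructor
  · rintro ((h | h) | h)
    · exact absurd h (hund _ _)
    · exact absurd h (hund _ _)
    · exact h
  · exact fun h => Or.inr h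

theorem IsBridgeless.deleteEdges_connected {G : MixedGraph V} (hG : G.IsBridgeless)
    (hund : G.IsUndirected) (a b : V) (hab : G.edges.Adj a b) :
    (G.edges.deleteEdges {s(a, b)}).Connected := by
  have h : (G.deleteEdge s(a, b)).underlying.Connected := by
    by_contra h
    exact hG.2 _ ⟨hab, h⟩
  have heq : (G.deleteEdge s(a, b)).underlying = G.edges.deleteEdges {s(a, b)} := by
    ext c d
    constructor
    · rintro (h | h | h)
      · exact h
      · exact absurd h (hund _ _)
      · exact absurd h (hund _ _)
    · exact fun h => Or.inl h
  rwa [heq] at h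

theorem IsBridgeless.orientedDiam_le_seven [Finite V] {G : MixedGraph V} {A B : Set V}
    (hAB : G.IsBipartiteWith A B) (hG : G.IsBridgeless) {u : V} (hu : u ∈ B)
    (hund : G.IsUndirected) :
    G.orientedDiam ≤ ((2 * (A.ncard - G.degree u) + 7 : ℕ) : ℕ∞) := by
  have hd : ∀ v, v ∈ A → v ∉ B := fun v hv hv' => Set.disjoint_left.1 hAB.2.1 hv hv'
  have hA : ∀ a b, G.edges.Adj a b → a ∈ A → b ∈ B := fun a b h ha =>
    ((hAB.2.2 a b (Or.inl h)).resolve_right fun h => hd a ha h.1).2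
  have hB : ∀ a b, G.edges.Adj a b → a ∈ B → b ∈ A := fun a b h ha =>
    ((hAB.2.2 a b (Or.inl h)).resolve_left fun h => hd a h.1 ha).2
  have hNA : G.edges.neighborSet u ⊆ A := fun v hv => hB u v hv hu
  obtain ⟨I, hI, hec⟩ := exists_isEconomical
    (fun a ha b hb h => hd b (hNA hb) (hA a b h (hNA ha))) (hG.deleteEdges_connected hund)
    hNA hA hB
  obtain ⟨D, hD, hsplit⟩ := exists_isSplit hG hund hI
  refine orientedDiam_le hD fun x y => ?_
  obtain ⟨s, hs, hxs, -, hxu, hsc, hsn⟩ := hsplit.exists_region_nearRoot hI x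
  obtain ⟨s', hs', -, -, huy, hsc', hsn'⟩ := hsplit.flip.exists_region_nearRoot hI.compl y
  rw [splitRegion_compl] at huy
  set S := splitRegion G.edges u I x s ∪ splitRegion G.edges u I y s' with hS
  have hreach : ReachIn D.Step S x y :=
    (hxu.mono (fun a b _ _ h => Or.inr h) Set.subset_union_left).trans
      (huy.swap.mono (fun a b _ _ h => Or.inr h) Set.subset_union_right)
  have hSN : S ∩ G.edges.neighborSet u ⊆ s ∪ s' := by
    rw [hS, Set.union_inter_distrib_right]
    exact Set.union_subset_union splitRegion_inter splitRegion_inter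
  have hcard := Set.ncard_le_ncard hSN (Set.toFinite _)
  have hun := Set.ncard_union_le s s'
  have h1 := ncard_inter_add_le (S := S) hNA
  rw [hund.degree_eq]
  refine (hD.1.isBipartiteWith hAB).dist_le hreach (Or.inl hxs) ?_
  -- Four neighbors of `u` give 8, and an end in `A` lowers this by 1. With both ends in `B`, the
  -- labelling saves a vertex of `A`, which gives 6.
  by_cases hxA : x ∈ A
  · rw [if_pos hxA]; omega
  by_cases hyA : y ∈ A
  · rw [if_pos hyA]; omega
  rw [if_neg hxA, if_neg hyA]
  rcases hec x y s s' hs hs' hsc hsc' (hsn fun h => hxA (hNA h)) (hsn' fun h => hyA (hNA h)) with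
    h | ⟨a, haA, haN, haS⟩
  · omega
  · change a ∉ S at haS
    have h2 := ncard_inter_add_le (S := S) (Set.insert_subset haA hNA)
    rw [Set.ncard_insert_of_notMem haN (Set.toFinite _), Set.inter_insert_of_notMem haS] at h2
    omega

end MixedGraph

theorem theorem1p5 {V : Type*} [Finite V] (G : MixedGraph V) (A B : Set V)
    (hAB : G.IsBipartiteWith A B) (hG : G.IsBridgeless) (u : V) (hu : u ∈ B) :
    (G.IsUndirected →
      G.orientedDiam ≤ ((2 * (A.ncard - G.degree u) + 7 : ℕ) : ℕ∞)) ∧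
    (2 ≤ G.outDegree u + G.inDegree u →
      G.orientedDiam ≤ ((2 * (A.ncard - G.undirDegree u) + 8 : ℕ) : ℕ∞)) ∧
    (¬ G.IsUndirected → ¬ 2 ≤ G.outDegree u + G.inDegree u →
      G.orientedDiam ≤ ((2 * (A.ncard - G.undirDegree u) + 10 : ℕ) : ℕ∞)) :=
  ⟨hG.orientedDiam_le_seven hAB hu, hG.orientedDiam_le_eight hAB hu,
    fun _ _ => hG.orientedDiam_le_ten hAB hu⟩
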